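/- For irrational $\theta\in(0,1)$ let $f=\chi_{[0,1/2]}-\chi_{(1/2,1)}$ on $[0,1)$, let $T(x)=x+\theta \bmod 1$, let $S_n(x)=\sum_{i=0}^{n-1} f(T^i x)$, and let $$H_\theta=\{x\in[0,1) : S_n(x)\ge 0 \text{ for all } n=1,2,\dots\}$$ be the heavy set of $\theta$. Write $[a_1,a_2,a_3,\dots]=\cfrac{1}{a_1+\cfrac{1}{a_2+\cdots}}$ for regular continued fractions. Let $$\alpha=e-2,\qquad \beta=\frac{e-1}{e+1}.$$ Then: 1. $\alpha=[1,2,1,1,4,1,1,6,1,\dots]$, that is, $a_{3k+1}=1$, $a_{3k+2}=2(k+1)$ and $a_{3k+3}=1$ for $k\ge 0$; and $\dim_H(H_\alpha)=0$. 2. $\beta=[2,6,10,14,\dots]$, that is, $a_k=4k-2$ for $k\ge 1$; moreover $\dim_H(H_\beta)=1/2$, and $H_\beta$ has no isolated points. Here $\dim_H$ denotes Hausdorff dimension. -/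

import Mathlib

noncomputable section

namespace HeavySets

/-- `f = χ_{[0,1/2]} - χ_{(1/2,1)}`, on the fundamental domain `[0,1)` of the circle `ℝ/ℤ`. -/
def signFun (x : ℝ) : ℤ :=
  Set.indicator (Set.Icc (0 : ℝ) (1 / 2)) 1 x - Set.indicator (Set.Ioo (1 / 2 : ℝ) 1) 1 x

/-- The rotation `T(x) = x + θ mod 1`, on the fundamental domain `[0,1)` of the circle. -/
def rot (θ : ℝ) (x : ℝ) : ℝ := Int.fract (x + θ)

/-- The discrepancy sums `S_n(x) = ∑_{i=0}^{n-1} f(T^i x)`. -/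
def discrepancy (θ : ℝ) (n : ℕ) (x : ℝ) : ℤ :=
  ∑ i ∈ Finset.range n, signFun ((rot θ)^[i] x)

/-- The heavy set `H_θ = {x ∈ [0,1) : S_n(x) ≥ 0 for n = 1, 2, …}`. -/
def heavySet (θ : ℝ) : Set ℝ :=
  {x | x ∈ Set.Ico (0 : ℝ) 1 ∧ ∀ n : ℕ, 1 ≤ n → 0 ≤ discrepancy θ n x}

/-- `θ = [a₁, a₂, a₃, …]`: the regular continued fraction expansion of `θ` is infinite, has
integer part `0`, and has successive partial quotients `a 0, a 1, a 2, …`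
(so `a n` is the partial quotient `a_{n+1}`). -/
def HasContFrac (θ : ℝ) (a : ℕ → ℕ) : Prop :=
  (GenContFract.of θ).h = 0 ∧ ∀ n : ℕ, (GenContFract.of θ).s.get? n = some ⟨1, (a n : ℝ)⟩

end HeavySets

end

/-! The proof is a renormalization along the Gauss map. Write `θ = 1/(a + η)` and `η = 1/(b + ζ)`.
Recording only one point per revolution turns the rotation by `θ` into the rotation by `-η` on
`[0,1)`, with `f` replaced by its sum over the revolution (`isInduced_revolution`). Within a
revolution the signs are first `+1`, then `-1`, so the partial sums are smallest at its ends and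
heaviness passes in both directions.

If `a` is even, the new function is a shrunken copy of `f` on `[0,η)` and zero elsewhere. Inducing
on `[0,η)` gives back the rotation by `ζ` with `f` itself (`isInduced_even`), so `H_θ` is built from
translates of `θη H_ζ`, about `b + 1` of them. For `β` all quotients are even: `8k + 7` copies
appear at a scale of order `k⁻²`. Counting copies bounds the dimension above by `1/2`
(`dimH_le_of_scaled_covers`); a coding by separated digits with Hölder inverse bounds it below
(`le_dimH_image_digitPoint`). Since every level has several copies, no point is isolated.

For `α` the quotients 1 interfere. The reflection `x ↦ 1/2 - x` exchanges `H_θ` and `H_{1-θ}`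
(`half_sub_mem_heavySet`) and replaces `[1, a, …]` by `[1 + a, …]`. If the first quotient is odd and
at least 3, and the second is 1, inducing on `[η,1)` leads to the rotation by `1 - ζ`
(`isInduced_odd`). Reflection, odd step, reflection and even step cover the heavy set by 12 copies
of a later one, at a ratio tending to 0; a bounded number of copies gives dimension 0.

Both expansions come from the three-term recurrence of a Bessel-type series (`lambertSum_eq`), which
yields Lambert's continued fraction of `tanh (1/2)`; the tails of `e - 2` are Möbius images of its
tails. -/

noncomputable section

namespace HeavySets

/-! ### Heavy points and induced systems -/

section Inducing

variable {X Y : Type*}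

/-- The Birkhoff sums of `g` along `T` at `x` are nonnegative up to time `n`. -/
def HeavyUpTo (T : X → X) (g : X → ℤ) (n : ℕ) (x : X) : Prop :=
  ∀ m ≤ n, 0 ≤ birkhoffSum T g m x

/-- All Birkhoff sums of `g` along `T` at `x` are nonnegative. -/
def Heavy (T : X → X) (g : X → ℤ) (x : X) : Prop :=
  ∀ m, 0 ≤ birkhoffSum T g m x

theorem heavy_iff_forall_heavyUpTo {T : X → X} {g : X → ℤ} {x : X} :
    Heavy T g x ↔ ∀ n, HeavyUpTo T g n x :=
  ⟨fun h _ m _ => h m, fun h m => h m m le_rfl⟩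

theorem HeavyUpTo.mono {T : X → X} {g : X → ℤ} {m n : ℕ} {x : X} (h : HeavyUpTo T g n x)
    (hmn : m ≤ n) : HeavyUpTo T g m x :=
  fun k hk => h k (hk.trans hmn)

theorem heavyUpTo_of_iterate {T : X → X} {g : X → ℤ} {k n : ℕ} {x : X}
    (h0 : ∀ m ≤ k, 0 ≤ birkhoffSum T g m x) (h : HeavyUpTo T g n (T^[k] x)) :
    HeavyUpTo T g (k + n) x := by
  intro m hm
  rcases le_total m k with hk | hk
  · exact h0 m hk
  · obtain ⟨i, rfl⟩ := Nat.exists_eq_add_of_le hk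
    rw [birkhoffSum_add]
    exact add_nonneg (h0 k le_rfl) (h i (by omega))

theorem heavy_of_iterate {T : X → X} {g : X → ℤ} {k : ℕ} {x : X}
    (h0 : ∀ m ≤ k, 0 ≤ birkhoffSum T g m x) (h : Heavy T g (T^[k] x)) : Heavy T g x :=
  heavy_iff_forall_heavyUpTo.2 fun n =>
    (heavyUpTo_of_iterate h0 (heavy_iff_forall_heavyUpTo.1 h n)).mono (by omega)

theorem Heavy.iterate {T : X → X} {g : X → ℤ} {k : ℕ} {x : X}
    (h : Heavy T g x) (h0 : birkhoffSum T g k x ≤ 0) : Heavy T g (T^[k] x) := by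
  intro m
  have := h (k + m)
  rw [birkhoffSum_add] at this
  omega

theorem heavy_apply_iff {T : X → X} {g : X → ℤ} {x : X} (h0 : g x = 0) :
    Heavy T g (T x) ↔ Heavy T g x := by
  constructor
  · intro h
    refine heavy_of_iterate (k := 1) (fun m hm => ?_) h
    interval_cases m <;> simp [h0]
  · intro h
    exact Heavy.iterate (k := 1) h (by simp [h0])

theorem heavyUpTo_of_apply {T : X → X} {g : X → ℤ} {n : ℕ} {x : X} (h0 : g x = 0)
    (h : HeavyUpTo T g n (T x)) : HeavyUpTo T g n x := by
  refine (heavyUpTo_of_iterate (k := 1) (fun m hm => ?_) h).mono (by omega)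
  interval_cases m <;> simp [h0]

/-- The system `(T', g')` on the invariant set `D` is induced from `(T, g)` through the embedding
`π`, with return time `r`, and the Birkhoff sums over an excursion are smallest at its ends. -/
structure IsInduced (T : X → X) (g : X → ℤ) (T' : Y → Y) (g' : Y → ℤ) (π : Y → X) (D : Set Y)
    (r : Y → ℕ) : Prop where
  pos : ∀ y ∈ D, 0 < r y
  mapsTo : ∀ y ∈ D, T' y ∈ D
  iterate : ∀ y ∈ D, T^[r y] (π y) = π (T' y)
  sum : ∀ y ∈ D, birkhoffSum T g (r y) (π y) = g' y
  excursion : ∀ y ∈ D, ∀ m ≤ r y, min 0 (g' y) ≤ birkhoffSum T g m (π y)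

namespace IsInduced

variable {T : X → X} {g : X → ℤ} {T' : Y → Y} {g' : Y → ℤ} {π : Y → X} {D : Set Y} {r : Y → ℕ}

theorem exists_birkhoffSum_eq (h : IsInduced T g T' g' π D r) (n : ℕ) :
    ∀ y ∈ D, ∃ N, birkhoffSum T g N (π y) = birkhoffSum T' g' n y := by
  induction n with
  | zero => exact fun y _ => ⟨0, by simp⟩
  | succ n ih =>
    intro y hy
    obtain ⟨N, hN⟩ := ih (T' y) (h.mapsTo y hy)
    refine ⟨r y + N, ?_⟩
    rw [birkhoffSum_add, birkhoffSum_succ', h.iterate y hy, h.sum y hy, hN]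

theorem heavy_of_heavy (h : IsInduced T g T' g' π D r) {y : Y} (hy : y ∈ D)
    (hh : Heavy T g (π y)) : Heavy T' g' y := by
  intro n
  obtain ⟨N, hN⟩ := h.exists_birkhoffSum_eq n y hy
  rw [← hN]
  exact hh N

/-- The bound `b` has to float: after an excursion the sums restart from level `g' y`, so the
induction continues with `b - g' y`. Excursions last at least `q` steps, hence `n` induced steps
control `q * n` original ones. -/
theorem birkhoffSum_ge (h : IsInduced T g T' g' π D r) {q : ℕ} (hq : ∀ y ∈ D, q ≤ r y) (n : ℕ) :
    ∀ y ∈ D, ∀ b : ℤ, b ≤ 0 → (∀ m ≤ n, b ≤ birkhoffSum T' g' m y) →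
      ∀ m ≤ q * n, b ≤ birkhoffSum T g m (π y) := by
  induction n with
  | zero =>
    intro y _ b hb _ m hm
    obtain rfl : m = 0 := by simpa using hm
    simpa using hb
  | succ n ih =>
    intro y hy b hb hs m hm
    have h1 : b ≤ g' y := by simpa using hs 1 (by omega)
    rcases le_total m (r y) with hr | hr
    · exact (le_min hb h1).trans (h.excursion y hy m hr)
    · obtain ⟨i, rfl⟩ := Nat.exists_eq_add_of_le hr
      rw [birkhoffSum_add, h.iterate y hy, h.sum y hy]
      have hq' := hq y hy
      have := ih (T' y) (h.mapsTo y hy) (b - g' y) (by omega) (fun k hk => by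
        have := hs (k + 1) (by omega)
        rw [birkhoffSum_succ'] at this
        omega) i (by rw [mul_add] at hm; omega)
      omega

theorem heavyUpTo (h : IsInduced T g T' g' π D r) {q : ℕ} (hq : ∀ y ∈ D, q ≤ r y) {n : ℕ} {y : Y}
    (hy : y ∈ D) (hh : HeavyUpTo T' g' n y) : HeavyUpTo T g (q * n) (π y) :=
  h.birkhoffSum_ge hq n y hy 0 le_rfl hh

theorem heavy_iff (h : IsInduced T g T' g' π D r) {y : Y} (hy : y ∈ D) :
    Heavy T g (π y) ↔ Heavy T' g' y := by
  refine ⟨h.heavy_of_heavy hy, fun hh => heavy_iff_forall_heavyUpTo.2 fun n => ?_⟩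
  have := h.heavyUpTo (q := 1) h.pos hy (heavy_iff_forall_heavyUpTo.1 hh n)
  simpa using this

end IsInduced

end Inducing

/-! ### The sign function, rotations and reflection -/

theorem mem_heavySet_iff {θ x : ℝ} :
    x ∈ heavySet θ ↔ x ∈ Set.Ico (0 : ℝ) 1 ∧ Heavy (rot θ) signFun x := by
  refine and_congr_right fun _ => ⟨fun h m => ?_, fun h m _ => h m⟩
  rcases Nat.eq_zero_or_pos m with rfl | hm
  · simp
  · exact h m hm

theorem signFun_of_le {x : ℝ} (h0 : 0 ≤ x) (h : x ≤ 1 / 2) : signFun x = 1 := by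
  have h1 : x ∈ Set.Icc (0 : ℝ) (1 / 2) := ⟨h0, h⟩
  have h2 : x ∉ Set.Ioo (1 / 2 : ℝ) 1 := fun h' => absurd h'.1 (not_lt.2 h)
  simp only [signFun, Set.indicator_of_mem h1, Set.indicator_of_notMem h2]
  rfl

theorem signFun_of_gt {x : ℝ} (h : 1 / 2 < x) (h' : x < 1) : signFun x = -1 := by
  have h1 : x ∉ Set.Icc (0 : ℝ) (1 / 2) := fun h1 => absurd h1.2 (not_le.2 h)
  have h2 : x ∈ Set.Ioo (1 / 2 : ℝ) 1 := ⟨h, h'⟩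
  simp only [signFun, Set.indicator_of_notMem h1, Set.indicator_of_mem h2]
  rfl

theorem le_half_of_mem_heavySet {θ x : ℝ} (h : x ∈ heavySet θ) : x ≤ 1 / 2 := by
  by_contra! hx
  have := h.2 1 le_rfl
  simp [discrepancy, signFun_of_gt hx h.1.2] at this

theorem rot_mem_Ico (θ x : ℝ) : rot θ x ∈ Set.Ico (0 : ℝ) 1 :=
  ⟨Int.fract_nonneg _, Int.fract_lt_one _⟩

theorem iterate_rot {θ x : ℝ} (hx : x ∈ Set.Ico (0 : ℝ) 1) (n : ℕ) :
    (rot θ)^[n] x = Int.fract (x + n * θ) := by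
  induction n with
  | zero => simp [Int.fract_eq_self.2 ⟨hx.1, hx.2⟩]
  | succ n ih =>
    rw [Function.iterate_succ_apply', ih, rot, Int.fract_eq_fract]
    refine ⟨-⌊x + n * θ⌋, ?_⟩
    rw [Int.fract]
    push_cast
    ring

theorem iterate_rot_eq {θ x y : ℝ} (hx : x ∈ Set.Ico (0 : ℝ) 1) (hy : y ∈ Set.Ico (0 : ℝ) 1) {n : ℕ}
    (z : ℤ) (h : x + n * θ - y = z) : (rot θ)^[n] x = y := by
  rw [iterate_rot hx, Int.fract_eq_iff]
  exact ⟨hy.1, hy.2, z, h⟩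

/-- The point reflection `x ↦ 1/2 - x` of the circle preserves `signFun`. -/
theorem signFun_fract_half_sub (z : ℝ) :
    signFun (Int.fract (1 / 2 - z)) = signFun (Int.fract z) := by
  have h0 := Int.fract_nonneg z
  have h1 := Int.fract_lt_one z
  have e : z = Int.fract z + ⌊z⌋ := (Int.fract_add_floor z).symm
  rcases le_or_gt (Int.fract z) (1 / 2) with h | h
  · have : Int.fract (1 / 2 - z) = 1 / 2 - Int.fract z := by
      rw [Int.fract_eq_iff]
      exact ⟨by linarith, by linarith, -⌊z⌋, by push_cast; linarith⟩
    rw [this, signFun_of_le h0 h, signFun_of_le (by linarith) (by linarith)]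
  · have : Int.fract (1 / 2 - z) = 3 / 2 - Int.fract z := by
      rw [Int.fract_eq_iff]
      exact ⟨by linarith, by linarith, -⌊z⌋ - 1, by push_cast; linarith⟩
    rw [this, signFun_of_gt h h1, signFun_of_gt (by linarith) (by linarith)]

/-- The reflection conjugates the rotation by `θ` to that by `-θ`, and it preserves `signFun`
everywhere because both end points of `[0,1/2]` carry the value 1. -/
theorem half_sub_mem_heavySet {θ x : ℝ} (h : x ∈ heavySet θ) : 1 / 2 - x ∈ heavySet (1 - θ) := by
  have hx := le_half_of_mem_heavySet h
  have hm : 1 / 2 - x ∈ Set.Ico (0 : ℝ) 1 := ⟨by linarith, by linarith [h.1.1]⟩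
  refine ⟨hm, fun n hn => ?_⟩
  convert! h.2 n hn using 1
  refine Finset.sum_congr rfl fun i _ => ?_
  rw [iterate_rot hm, iterate_rot h.1, ← signFun_fract_half_sub (x + i * θ)]
  congr 1
  rw [Int.fract_eq_fract]
  exact ⟨i, by push_cast; ring⟩

/-! ### Inducing on one revolution -/

/-- The rotation by `-η` on `[0,1)`. -/
def backRot (η y : ℝ) : ℝ := if y < η then y + 1 - η else y - η

theorem backRot_mem_Ico {η y : ℝ} (hη : η ∈ Set.Ioo (0 : ℝ) 1) (hy : y ∈ Set.Ico (0 : ℝ) 1) :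
    backRot η y ∈ Set.Ico (0 : ℝ) 1 := by
  have := hη.1; have := hη.2; have := hy.1; have := hy.2
  unfold backRot
  split_ifs <;> constructor <;> linarith

/-- The number of orbit points in a revolution of the rotation by `θ = 1 / (a + η)` that starts at
`θ * y`, for `y ∈ [0,1)`. -/
def visits (a : ℕ) (η y : ℝ) : ℕ := if y < η then a + 1 else a

/-- The number of orbit points in `[0,1/2]` in the revolution counted by `visits`. -/
def posVisits (a : ℕ) (η y : ℝ) : ℕ := ⌊(a + η) / 2 - y⌋₊ + 1

/-- The sum of `signFun` over the revolution counted by `visits`. -/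
def revSum (a : ℕ) (η y : ℝ) : ℤ := 2 * posVisits a η y - visits a η y

section Revolution

variable {θ η : ℝ} {a : ℕ}

theorem lt_visits_iff (hθ : θ * (a + η) = 1) (h0 : 0 < θ) (hη : η ∈ Set.Ioo (0 : ℝ) 1) {y : ℝ}
    (hy : y ∈ Set.Ico (0 : ℝ) 1) (i : ℕ) : i < visits a η y ↔ θ * (y + i) < 1 := by
  rw [← hθ, mul_lt_mul_iff_right₀ h0]
  have := hη.1; have := hη.2; have := hy.1; have := hy.2
  unfold visits
  split_ifs with h
  · rw [Nat.lt_succ_iff]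
    constructor
    · intro hi
      have : (i : ℝ) ≤ a := by exact_mod_cast hi
      linarith
    · intro hi
      by_contra! hc
      have : (a : ℝ) + 1 ≤ i := by exact_mod_cast hc
      linarith
  · constructor
    · intro hi
      have : (i : ℝ) + 1 ≤ a := by exact_mod_cast hi
      linarith
    · intro hi
      by_contra! hc
      have : (a : ℝ) ≤ i := by exact_mod_cast hc
      linarith

theorem lt_posVisits_iff (hθ : θ * (a + η) = 1) (h0 : 0 < θ) (ha : 2 ≤ a)
    (hη : η ∈ Set.Ioo (0 : ℝ) 1) {y : ℝ} (hy : y ∈ Set.Ico (0 : ℝ) 1) (i : ℕ) :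
    i < posVisits a η y ↔ θ * (y + i) ≤ 1 / 2 := by
  have e : (1 : ℝ) / 2 = θ * ((a + η) / 2) := by rw [← hθ]; ring
  have ha' : (2 : ℝ) ≤ a := by exact_mod_cast ha
  have := hη.1; have := hη.2; have := hy.1; have := hy.2
  rw [e, mul_le_mul_iff_right₀ h0, posVisits, Nat.lt_succ_iff, Nat.le_floor_iff (by linarith)]
  constructor <;> intro <;> linarith

theorem posVisits_le_visits (hθ : θ * (a + η) = 1) (h0 : 0 < θ) (ha : 2 ≤ a)
    (hη : η ∈ Set.Ioo (0 : ℝ) 1) {y : ℝ} (hy : y ∈ Set.Ico (0 : ℝ) 1) :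
    posVisits a η y ≤ visits a η y := by
  by_contra! hc
  have h1 := (lt_posVisits_iff hθ h0 ha hη hy _).1 hc
  exact lt_irrefl _ ((lt_visits_iff hθ h0 hη hy _).2 (by linarith))

theorem two_le_visits (ha : 2 ≤ a) (y : ℝ) : 2 ≤ visits a η y := by
  unfold visits; split_ifs <;> omega

theorem mul_add_mem_Ico (hθ : θ * (a + η) = 1) (h0 : 0 < θ) (hη : η ∈ Set.Ioo (0 : ℝ) 1) {y : ℝ}
    (hy : y ∈ Set.Ico (0 : ℝ) 1) {i : ℕ} (hi : i < visits a η y) :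
    θ * (y + i) ∈ Set.Ico (0 : ℝ) 1 :=
  ⟨mul_nonneg h0.le (add_nonneg hy.1 i.cast_nonneg), (lt_visits_iff hθ h0 hη hy i).1 hi⟩

/-- Positions below `posVisits` carry `+1`, later ones `-1`. The starting position `k` is free
because heavy points may also start at position 1. -/
theorem birkhoffSum_rot_mul_add (hθ : θ * (a + η) = 1) (h0 : 0 < θ) (ha : 2 ≤ a)
    (hη : η ∈ Set.Ioo (0 : ℝ) 1) {y : ℝ} (hy : y ∈ Set.Ico (0 : ℝ) 1) (k m : ℕ)
    (hkm : k + m ≤ visits a η y) :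
    birkhoffSum (rot θ) signFun m (θ * (y + k)) =
      2 * (min (k + m) (posVisits a η y) : ℕ) - 2 * (min k (posVisits a η y) : ℕ) - m := by
  induction m with
  | zero => simp
  | succ m ih =>
    rw [birkhoffSum_succ, ih (by omega)]
    have hk := mul_add_mem_Ico hθ h0 hη hy (i := k) (by omega)
    have hm := mul_add_mem_Ico hθ h0 hη hy (i := k + m) (by omega)
    rw [iterate_rot_eq hk hm 0 (by push_cast; ring)]
    by_cases hp : k + m < posVisits a η y
    · rw [signFun_of_le hm.1 ((lt_posVisits_iff hθ h0 ha hη hy _).1 hp)]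
      have h1 : min (k + m) (posVisits a η y) = k + m := by omega
      have h2 : min (k + (m + 1)) (posVisits a η y) = k + m + 1 := by omega
      rw [h1, h2]; push_cast; ring
    · rw [signFun_of_gt (not_le.1 (mt (lt_posVisits_iff hθ h0 ha hη hy _).2 hp)) hm.2]
      have h1 : min (k + m) (posVisits a η y) = posVisits a η y := by omega
      have h2 : min (k + (m + 1)) (posVisits a η y) = posVisits a η y := by omega
      rw [h1, h2]; push_cast; ring

theorem iterate_rot_visits (hθ : θ * (a + η) = 1) (h0 : 0 < θ) (ha : 2 ≤ a)
    (hη : η ∈ Set.Ioo (0 : ℝ) 1) {y : ℝ} (hy : y ∈ Set.Ico (0 : ℝ) 1) {k : ℕ}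
    (hk : k < visits a η y) :
    (rot θ)^[visits a η y - k] (θ * (y + k)) = θ * backRot η y := by
  have hb := backRot_mem_Ico hη hy
  have ha' : (2 : ℝ) ≤ a := by exact_mod_cast ha
  refine iterate_rot_eq (mul_add_mem_Ico hθ h0 hη hy hk) ⟨mul_nonneg h0.le hb.1, ?_⟩ 1 ?_
  · rw [← hθ]
    exact mul_lt_mul_of_pos_left (by linarith [hb.2, hη.1]) h0
  · rw [Nat.cast_sub hk.le, Int.cast_one, ← hθ]
    unfold visits backRot
    split_ifs <;> push_cast <;> ring

/-- A revolution with `N` visits ends at `θ (y + N) - 1 = θ (y + N - a - η)`, whence the rotation by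
`-η`. Its sums climb and then fall, so they are smallest at the ends. -/
theorem isInduced_revolution (hθ : θ * (a + η) = 1) (h0 : 0 < θ) (ha : 2 ≤ a)
    (hη : η ∈ Set.Ioo (0 : ℝ) 1) :
    IsInduced (rot θ) signFun (backRot η) (revSum a η) (fun y => θ * y) (Set.Ico 0 1)
      (visits a η) where
  pos y _ := by have := two_le_visits (η := η) ha y; omega
  mapsTo y hy := backRot_mem_Ico hη hy
  iterate y hy := by
    have := iterate_rot_visits hθ h0 ha hη hy (k := 0)
      (by have := two_le_visits (η := η) ha y; omega)
    simpa using this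
  sum y hy := by
    have := birkhoffSum_rot_mul_add hθ h0 ha hη hy 0 (visits a η y) (by omega)
    have h := posVisits_le_visits hθ h0 ha hη hy
    simp only [Nat.cast_zero, add_zero, zero_add, Nat.zero_min, mul_zero, sub_zero] at this
    rw [this, min_eq_right h, revSum]
  excursion y hy m hm := by
    have := birkhoffSum_rot_mul_add hθ h0 ha hη hy 0 m (by omega)
    have h := posVisits_le_visits hθ h0 ha hη hy
    simp only [Nat.cast_zero, add_zero, zero_add, Nat.zero_min, mul_zero, sub_zero] at this
    rw [this, revSum]
    omega

theorem revSum_le_one (ha : 2 ≤ a) (hη : η ∈ Set.Ioo (0 : ℝ) 1) {y : ℝ}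
    (hy : y ∈ Set.Ico (0 : ℝ) 1) : revSum a η y ≤ 1 := by
  have ha' : (2 : ℝ) ≤ a := by exact_mod_cast ha
  have := hη.1; have := hη.2; have := hy.1; have := hy.2
  have h := Nat.floor_le (a := (a + η) / 2 - y) (by linarith)
  set p := ⌊(a + η) / 2 - y⌋₊ with hp
  unfold revSum posVisits visits
  rw [← hp]
  split_ifs with h1
  · have : (2 * p : ℝ) < a + 1 := by linarith
    have : 2 * p < a + 1 := by exact_mod_cast this
    omega
  · have : (2 * p : ℝ) < a := by linarith
    have : 2 * p < a := by exact_mod_cast this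
    omega

/-- Heavy points lie in the first interval `[0,θ)`, or in the second one above a point whose
revolution has sum `1`. -/
theorem mem_heavySet_iff_revolution (hθ : θ * (a + η) = 1) (h0 : 0 < θ) (ha : 2 ≤ a)
    (hη : η ∈ Set.Ioo (0 : ℝ) 1) {x : ℝ} :
    x ∈ heavySet θ ↔ ∃ y ∈ Set.Ico (0 : ℝ) 1,
      (x = θ * y ∧ Heavy (backRot η) (revSum a η) y) ∨
      (x = θ * (y + 1) ∧ revSum a η y = 1 ∧ Heavy (backRot η) (revSum a η) (backRot η y)) := by
  have ind := isInduced_revolution hθ h0 ha hη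
  constructor
  · intro hx
    have hh := (mem_heavySet_iff.1 hx).2
    have hy : Int.fract (x / θ) ∈ Set.Ico (0 : ℝ) 1 := ⟨Int.fract_nonneg _, Int.fract_lt_one _⟩
    set y := Int.fract (x / θ) with hydef
    have hxθ : 0 ≤ x / θ := div_nonneg hx.1.1 h0.le
    obtain ⟨k, hk⟩ := Int.eq_ofNat_of_zero_le (Int.floor_nonneg.2 hxθ)
    have hxy : x = θ * (y + k) := by
      have := Int.fract_add_floor (x / θ)
      rw [← hydef, hk] at this
      push_cast at this
      rw [this]; field_simp
    have hkp : k < posVisits a η y := by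
      rw [lt_posVisits_iff hθ h0 ha hη hy, ← hxy]
      exact le_half_of_mem_heavySet hx
    have hpN := posVisits_le_visits hθ h0 ha hη hy
    have hs := birkhoffSum_rot_mul_add hθ h0 ha hη hy k (visits a η y - k) (by omega)
    have hge := hh (visits a η y - k)
    rw [← hxy] at hs
    have hsum : birkhoffSum (rot θ) signFun (visits a η y - k) x = revSum a η y - k := by
      rw [hs, revSum]; omega
    have h1 := revSum_le_one ha hη hy
    refine ⟨y, hy, ?_⟩
    -- The rest of the revolution sums to `revSum - k`, which is nonnegative by heaviness, while
    -- `revSum ≤ 1`.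
    have hk1 : k = 0 ∨ k = 1 := by omega
    rcases hk1 with rfl | rfl
    · left
      have e : x = θ * y := by simpa using hxy
      refine ⟨e, ind.heavy_of_heavy hy ?_⟩
      rwa [e] at hh
    · right
      have e : x = θ * (y + 1) := by simpa using hxy
      refine ⟨e, by push_cast at hsum; omega, ind.heavy_of_heavy (backRot_mem_Ico hη hy) ?_⟩
      have := hh.iterate (k := visits a η y - 1) (by push_cast at hsum; omega)
      rw [e] at this
      have e2 := iterate_rot_visits hθ h0 ha hη hy (k := 1) (by omega)
      rw [Nat.cast_one] at e2
      rwa [e2] at this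
  · rintro ⟨y, hy, ⟨rfl, hh⟩ | ⟨rfl, h1, hh⟩⟩
    · have hN := two_le_visits (η := η) ha y
      have hm := mul_add_mem_Ico hθ h0 hη hy (i := 0) (by omega)
      exact mem_heavySet_iff.2 ⟨by simpa using hm, (ind.heavy_iff hy).2 hh⟩
    · have hN := two_le_visits (η := η) ha y
      have hpN := posVisits_le_visits hθ h0 ha hη hy
      have hm := mul_add_mem_Ico hθ h0 hη hy (i := 1) (by omega)
      rw [Nat.cast_one] at hm
      refine mem_heavySet_iff.2 ⟨hm, heavy_of_iterate (k := visits a η y - 1) (fun m hm => ?_) ?_⟩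
      · have hs := birkhoffSum_rot_mul_add hθ h0 ha hη hy 1 m (by omega)
        rw [Nat.cast_one] at hs
        rw [hs]
        unfold revSum at h1
        omega
      · have e2 := iterate_rot_visits hθ h0 ha hη hy (k := 1) (by omega)
        rw [Nat.cast_one] at e2
        rw [e2]
        exact (ind.heavy_iff (backRot_mem_Ico hη hy)).2 hh

end Revolution

/-! ### Even first partial quotient -/

section Even

variable {θ η ζ : ℝ} {a b n : ℕ}

theorem revSum_even_of_le (hη : η ∈ Set.Ioo (0 : ℝ) 1) {y : ℝ}
    (h0 : 0 ≤ y) (hy : y ≤ η / 2) : revSum (2 * n) η y = 1 := by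
  have := hη.1; have := hη.2
  have hf : ⌊((2 * n : ℕ) + η) / 2 - y⌋₊ = n := by
    rw [Nat.floor_eq_iff (by push_cast; linarith [n.cast_nonneg (α := ℝ)])]
    push_cast
    constructor <;> linarith
  rw [revSum, posVisits, hf, visits, if_pos (by linarith)]
  push_cast; ring

theorem revSum_even_of_gt (hn : 1 ≤ n) (hη : η ∈ Set.Ioo (0 : ℝ) 1) {y : ℝ}
    (h0 : η / 2 < y) (hy : y < 1) : ⌊((2 * n : ℕ) + η) / 2 - y⌋₊ = n - 1 := by
  have := hη.1; have := hη.2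
  have hn' : (1 : ℝ) ≤ n := by exact_mod_cast hn
  rw [Nat.floor_eq_iff (by push_cast; linarith)]
  push_cast [Nat.cast_sub hn]
  constructor <;> linarith

theorem revSum_even_of_mem_Ioo (hn : 1 ≤ n) (hη : η ∈ Set.Ioo (0 : ℝ) 1) {y : ℝ}
    (h0 : η / 2 < y) (hy : y < η) : revSum (2 * n) η y = -1 := by
  rw [revSum, posVisits, revSum_even_of_gt hn hη h0 (hy.trans hη.2), visits, if_pos hy]
  omega

theorem revSum_even_of_ge (hn : 1 ≤ n) (hη : η ∈ Set.Ioo (0 : ℝ) 1) {y : ℝ}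
    (h0 : η ≤ y) (hy : y < 1) : revSum (2 * n) η y = 0 := by
  rw [revSum, posVisits, revSum_even_of_gt hn hη (by linarith [hη.1]) hy, visits,
    if_neg (by linarith)]
  omega

theorem revSum_even_mul (hn : 1 ≤ n) (hη : η ∈ Set.Ioo (0 : ℝ) 1) {w : ℝ}
    (hw : w ∈ Set.Ico (0 : ℝ) 1) : revSum (2 * n) η (η * w) = signFun w := by
  rcases le_or_gt w (1 / 2) with h | h
  · rw [signFun_of_le hw.1 h, revSum_even_of_le hη (mul_nonneg hη.1.le hw.1)
      (by nlinarith [hη.1])]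
  · rw [signFun_of_gt h hw.2, revSum_even_of_mem_Ioo hn hη (by nlinarith [hη.1])
      (by nlinarith [hη.1, hw.2])]

theorem iterate_backRot_add (j : ℕ) {y : ℝ} (hη : 0 ≤ η) (hy : 0 ≤ y) :
    (backRot η)^[j] (y + j * η) = y := by
  induction j with
  | zero => simp
  | succ j ih =>
    have hj : 0 ≤ (j : ℝ) * η := by positivity
    rw [Function.iterate_succ_apply, backRot, if_neg (by push_cast; linarith)]
    convert! ih using 2
    push_cast; ring

theorem birkhoffSum_backRot_eq_zero {g : ℝ → ℤ} (hη : 0 ≤ η)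
    (hg : ∀ y, η ≤ y → y < 1 → g y = 0) (m : ℕ) :
    ∀ (j : ℕ) (y : ℝ), m ≤ j → 0 ≤ y → y + j * η < 1 →
      birkhoffSum (backRot η) g m (y + j * η) = 0 := by
  induction m with
  | zero => simp
  | succ m ih =>
    intro j y hm hy h1
    obtain ⟨j, rfl⟩ : ∃ i, j = i + 1 := ⟨j - 1, by omega⟩
    have hj : 0 ≤ (j : ℝ) * η := by positivity
    push_cast at h1 ⊢
    rw [birkhoffSum_succ', hg _ (by linarith) h1, backRot, if_neg (by linarith),
      show y + (j + 1) * η - η = y + j * η by ring, ih j y (by omega) hy (by linarith), add_zero]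

/-- The rotation by `-η` lifts `η w` to the top of `[0,1)`; the point then descends in steps of `η`
through the region where the sums vanish. As `1/η = b + ζ`, it comes back at `w + ζ` mod 1 in units
of `η`: the two orientation reversals cancel. -/
theorem isInduced_even (hn : 1 ≤ n) (hη : η ∈ Set.Ioo (0 : ℝ) 1) (hζ : ζ ∈ Set.Ico (0 : ℝ) 1)
    (hb : 1 ≤ b) (h : η * (b + ζ) = 1) :
    IsInduced (backRot η) (revSum (2 * n) η) (rot ζ) signFun (fun w => η * w) (Set.Ico 0 1)
      (fun w => b + ⌊w + ζ⌋₊) := by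
  have key : ∀ w ∈ Set.Ico (0 : ℝ) 1,
      backRot η (η * w) = η * rot ζ w + ((b - 1 + ⌊w + ζ⌋₊ : ℕ) : ℝ) * η := by
    intro w hw
    have hf : ((⌊w + ζ⌋₊ : ℕ) : ℝ) = (⌊w + ζ⌋ : ℝ) :=
      natCast_floor_eq_intCast_floor (by linarith [hw.1, hζ.1])
    rw [backRot, if_pos (by nlinarith [hη.1, hw.2]), rot, Int.fract]
    push_cast [Nat.cast_sub hb]
    rw [hf]
    linear_combination -h
  have hlt : ∀ w ∈ Set.Ico (0 : ℝ) 1,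
      η * rot ζ w + ((b - 1 + ⌊w + ζ⌋₊ : ℕ) : ℝ) * η < 1 := by
    intro w hw
    rw [← key w hw, backRot, if_pos (by nlinarith [hη.1, hw.2])]
    nlinarith [hη.1, hw.2]
  have h0 : ∀ w, 0 ≤ η * rot ζ w := fun w => mul_nonneg hη.1.le (rot_mem_Ico ζ w).1
  have sums : ∀ w ∈ Set.Ico (0 : ℝ) 1, ∀ m ≤ b - 1 + ⌊w + ζ⌋₊,
      birkhoffSum (backRot η) (revSum (2 * n) η) (m + 1) (η * w) = signFun w := by
    intro w hw m hm
    rw [birkhoffSum_succ', key w hw, birkhoffSum_backRot_eq_zero hη.1.le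
      (fun y hy hy' => revSum_even_of_ge hn hη hy hy') m _ _ hm (h0 w) (hlt w hw),
      revSum_even_mul hn hη hw, add_zero]
  have e : ∀ w : ℝ, b + ⌊w + ζ⌋₊ = b - 1 + ⌊w + ζ⌋₊ + 1 := fun w => by omega
  refine ⟨fun w _ => by omega, fun w _ => rot_mem_Ico ζ w, fun w hw => ?_,
    fun w hw => ?_, fun w hw m hm => ?_⟩
  · simp only [e]
    rw [Function.iterate_succ_apply, key w hw, iterate_backRot_add _ hη.1.le (h0 w)]
  · simp only [e]
    exact sums w hw _ le_rfl
  · rcases m with _ | m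
    · simp
    · rw [sums w hw m (by omega)]
      exact min_le_right _ _

/-- Points above `[0,η)` slide down to it through the zero region, so their sums are not affected.
-/
theorem heavy_backRot_even_iff (hn : 1 ≤ n) (hη : η ∈ Set.Ioo (0 : ℝ) 1)
    (hζ : ζ ∈ Set.Ico (0 : ℝ) 1) (hb : 1 ≤ b) (h : η * (b + ζ) = 1) {w : ℝ}
    (hw : w ∈ Set.Ico (0 : ℝ) 1) (j : ℕ) (hj : η * (j + w) < 1) :
    Heavy (backRot η) (revSum (2 * n) η) (η * (j + w)) ↔ w ∈ heavySet ζ := by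
  induction j with
  | zero =>
    rw [mem_heavySet_iff, Nat.cast_zero, zero_add]
    exact ((isInduced_even hn hη hζ hb h).heavy_iff hw).trans (by simp [hw.1, hw.2])
  | succ j ih =>
    have h1 : 0 ≤ η * (j + w) := mul_nonneg hη.1.le (add_nonneg j.cast_nonneg hw.1)
    push_cast at hj ⊢
    rw [← ih (by nlinarith [hη.1]), ← heavy_apply_iff (x := η * (j + 1 + w))
      (revSum_even_of_ge hn hη (by linarith) hj), backRot, if_neg (by linarith)]
    ring_nf

theorem heavyUpTo_backRot_even (hn : 1 ≤ n) (hη : η ∈ Set.Ioo (0 : ℝ) 1)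
    (hζ : ζ ∈ Set.Ico (0 : ℝ) 1) (hb : 1 ≤ b) (h : η * (b + ζ) = 1) {w : ℝ}
    (hw : w ∈ Set.Ico (0 : ℝ) 1) {N : ℕ} (hN : HeavyUpTo (rot ζ) signFun N w) (j : ℕ)
    (hj : η * (j + w) < 1) :
    HeavyUpTo (backRot η) (revSum (2 * n) η) N (η * (j + w)) := by
  induction j with
  | zero =>
    have ind := isInduced_even hn hη hζ hb h
    simpa using ind.heavyUpTo (q := 1) ind.pos hw hN
  | succ j ih =>
    have h1 : 0 ≤ η * (j + w) := mul_nonneg hη.1.le (add_nonneg j.cast_nonneg hw.1)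
    push_cast at hj ⊢
    refine heavyUpTo_of_apply (revSum_even_of_ge hn hη (by linarith) hj) ?_
    rw [backRot, if_neg (by linarith)]
    convert! ih (by nlinarith [hη.1]) using 1
    ring

theorem exists_nat_add_of_nonneg {η y : ℝ} (hη : 0 < η) (hy : 0 ≤ y) :
    ∃ j : ℕ, ∃ w ∈ Set.Ico (0 : ℝ) 1, y = η * (j + w) := by
  have h0 : 0 ≤ y / η := div_nonneg hy hη.le
  refine ⟨⌊y / η⌋₊, Int.fract (y / η), ⟨Int.fract_nonneg _, Int.fract_lt_one _⟩, ?_⟩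
  rw [natCast_floor_eq_intCast_floor h0, Int.floor_add_fract]
  field_simp

/-- If the first partial quotient is even, every heavy point is a translate of a scaled heavy point
of the rotation two steps further along the Gauss map. -/
theorem exists_of_mem_heavySet_even (hn : 1 ≤ n) (h0 : 0 < θ) (hθ : θ * ((2 * n : ℕ) + η) = 1)
    (hη : η ∈ Set.Ioo (0 : ℝ) 1) (hζ : ζ ∈ Set.Ico (0 : ℝ) 1) (hb : 1 ≤ b)
    (h : η * (b + ζ) = 1) {x : ℝ} (hx : x ∈ heavySet θ) :
    ∃ j : ℕ, ∃ w ∈ heavySet ζ, x = θ * η * (j + w) ∧ η * (j + w) ≤ 1 + η / 2 := by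
  obtain ⟨y, hy, ⟨rfl, hh⟩ | ⟨rfl, h1, hh⟩⟩ :=
    (mem_heavySet_iff_revolution hθ h0 (by omega) hη).1 hx
  · obtain ⟨j, w, hw, rfl⟩ := exists_nat_add_of_nonneg hη.1 hy.1
    exact ⟨j, w, (heavy_backRot_even_iff hn hη hζ hb h hw j hy.2).1 hh, by ring,
      by linarith [hy.2, hη.1]⟩
  · have hy2 : y ≤ η / 2 := by
      by_contra! hc
      rcases lt_or_ge y η with h' | h'
      · rw [revSum_even_of_mem_Ioo hn hη hc h'] at h1; omega
      · rw [revSum_even_of_ge hn hη h' hy.2] at h1; omega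
    have hb1 := backRot_mem_Ico hη hy
    have he : backRot η y = y + 1 - η := if_pos (by linarith [hη.1])
    obtain ⟨j, w, hw, e⟩ := exists_nat_add_of_nonneg hη.1 hb1.1
    have e' : η * ((j + 1 : ℕ) + w) = y + 1 := by push_cast; linarith
    rw [e] at hb1 hh
    exact ⟨j + 1, w, (heavy_backRot_even_iff hn hη hζ hb h hw j hb1.2).1 hh,
      by rw [mul_assoc, e'], by linarith⟩

/-- If `η (j + w) ≥ 1`, then `j = b` and the point is at position 1 of a revolution whose sum has to
be 1. This holds because `w ≤ 1/2` for heavy `w`. -/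
theorem mem_heavySet_even (hn : 1 ≤ n) (h0 : 0 < θ) (hθ : θ * ((2 * n : ℕ) + η) = 1)
    (hη : η ∈ Set.Ioo (0 : ℝ) 1) (hζ : ζ ∈ Set.Ico (0 : ℝ) 1) (hb : 1 ≤ b)
    (h : η * (b + ζ) = 1) {w : ℝ} (hw : w ∈ heavySet ζ) {j : ℕ} (hj : j ≤ b) :
    θ * η * (j + w) ∈ heavySet θ := by
  rw [mem_heavySet_iff_revolution hθ h0 (by omega) hη]
  have hw2 := le_half_of_mem_heavySet hw
  have hpos : 0 ≤ η * (j + w) := mul_nonneg hη.1.le (add_nonneg j.cast_nonneg hw.1.1)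
  rcases lt_or_ge (η * (j + w)) 1 with h1 | h1
  · exact ⟨η * (j + w), ⟨hpos, h1⟩, Or.inl ⟨by ring,
      (heavy_backRot_even_iff hn hη hζ hb h hw.1 j h1).2 hw⟩⟩
  · have hjb : j = b := by
      refine le_antisymm hj ?_
      by_contra! hc
      have : (j : ℝ) + 1 ≤ b := by exact_mod_cast hc
      nlinarith [hη.1, hζ.1]
    subst hjb
    obtain ⟨i, rfl⟩ : ∃ i, j = i + 1 := ⟨j - 1, by omega⟩
    have hy : η * ((i + 1 : ℕ) + w) - 1 ≤ η / 2 := by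
      rw [← h]
      nlinarith [hη.1, hζ.1]
    have hI : η * ((i + 1 : ℕ) + w) - 1 ∈ Set.Ico (0 : ℝ) 1 := ⟨by linarith, by linarith [hη.2]⟩
    refine ⟨η * ((i + 1 : ℕ) + w) - 1, hI, Or.inr ⟨by ring, revSum_even_of_le hη hI.1 hy, ?_⟩⟩
    have he : backRot η (η * ((i + 1 : ℕ) + w) - 1) = η * (i + w) := by
      rw [backRot, if_pos (by linarith [hη.1])]
      push_cast; ring
    have hm := backRot_mem_Ico hη hI
    rw [he] at hm ⊢
    exact (heavy_backRot_even_iff hn hη hζ hb h hw.1 i hm.2).2 hw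

/-- A point coded by infinitely many digits never reaches a last renormalization. Instead, every
renormalization lengthens the time of heaviness by at least one, which drives the induction in
`heavyUpTo_digitPoint`. -/
theorem heavyUpTo_rot_even (hn : 1 ≤ n) (h0 : 0 < θ) (hθ : θ * ((2 * n : ℕ) + η) = 1)
    (hη : η ∈ Set.Ioo (0 : ℝ) 1) (hζ : ζ ∈ Set.Ico (0 : ℝ) 1) (hb : 1 ≤ b)
    (h : η * (b + ζ) = 1) {w : ℝ} (hw : w ∈ Set.Ico (0 : ℝ) 1) {N : ℕ}
    (hN : HeavyUpTo (rot ζ) signFun N w) {j : ℕ} (hj : j + 1 ≤ b) :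
    HeavyUpTo (rot θ) signFun (N + 1) (θ * η * (j + w)) := by
  have hj' : (j : ℝ) + 1 ≤ b := by exact_mod_cast hj
  have h1 : η * (j + w) < 1 := by rw [← h]; nlinarith [hη.1, hζ.1, hw.2]
  have hpos : 0 ≤ η * (j + w) := mul_nonneg hη.1.le (add_nonneg j.cast_nonneg hw.1)
  have ind := isInduced_revolution hθ h0 (by omega) hη
  have := ind.heavyUpTo (q := 2) (fun y _ => two_le_visits (by omega) y) (y := η * (j + w))
    ⟨hpos, h1⟩ (heavyUpTo_backRot_even hn hη hζ hb h hw hN j h1)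
  rw [mul_assoc]
  -- Two visits per revolution double the time, which gives nothing for `N = 0`. There the point
  -- itself lies in `[0,1/2]`, since `θ ≤ 1/2`.
  rcases Nat.eq_zero_or_pos N with rfl | hN0
  · intro m hm
    have hn' : (1 : ℝ) ≤ n := by exact_mod_cast hn
    interval_cases m
    · simp
    · rw [birkhoffSum_one, signFun_of_le (mul_nonneg h0.le hpos)]
      · norm_num
      · push_cast at hθ
        nlinarith [hη.1]
  · exact this.mono (by omega)

end Even

/-! ### Odd first partial quotient followed by 1 -/

section Odd

variable {θ η ξ ζ : ℝ} {b n : ℕ}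

theorem revSum_odd_of_lt (hη : η ∈ Set.Ioo (0 : ℝ) 1) {y : ℝ}
    (h0 : 0 ≤ y) (hy : y < η) : revSum (2 * n + 1) η y = 0 := by
  have := hη.1; have := hη.2
  have hf : ⌊((2 * n + 1 : ℕ) + η) / 2 - y⌋₊ = n := by
    rw [Nat.floor_eq_iff (by push_cast; linarith [n.cast_nonneg (α := ℝ)])]
    push_cast
    constructor <;> linarith
  rw [revSum, posVisits, hf, visits, if_pos hy]
  push_cast; ring

theorem revSum_odd_of_le (hη : η ∈ Set.Ioo (0 : ℝ) 1) {y : ℝ}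
    (h0 : η ≤ y) (hy : y ≤ (1 + η) / 2) : revSum (2 * n + 1) η y = 1 := by
  have := hη.1; have := hη.2
  have hf : ⌊((2 * n + 1 : ℕ) + η) / 2 - y⌋₊ = n := by
    rw [Nat.floor_eq_iff (by push_cast; linarith [n.cast_nonneg (α := ℝ)])]
    push_cast
    constructor <;> linarith
  rw [revSum, posVisits, hf, visits, if_neg (by linarith)]
  push_cast; ring

theorem revSum_odd_of_gt (hn : 1 ≤ n) (hη : η ∈ Set.Ioo (0 : ℝ) 1) {y : ℝ}
    (h0 : (1 + η) / 2 < y) (hy : y < 1) : revSum (2 * n + 1) η y = -1 := by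
  have := hη.1; have := hη.2
  have hn' : (1 : ℝ) ≤ n := by exact_mod_cast hn
  have hf : ⌊((2 * n + 1 : ℕ) + η) / 2 - y⌋₊ = n - 1 := by
    rw [Nat.floor_eq_iff (by push_cast; linarith)]
    push_cast [Nat.cast_sub hn]
    constructor <;> linarith
  rw [revSum, posVisits, hf, visits, if_neg (by linarith)]
  omega

theorem revSum_odd_affine (hn : 1 ≤ n) (hη : η ∈ Set.Ioo (0 : ℝ) 1) {w : ℝ}
    (hw : w ∈ Set.Ico (0 : ℝ) 1) : revSum (2 * n + 1) η (η + (1 - η) * w) = signFun w := by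
  have := hη.1; have := hη.2
  rcases le_or_gt w (1 / 2) with h | h
  · rw [signFun_of_le hw.1 h, revSum_odd_of_le hη (by nlinarith [hw.1]) (by nlinarith)]
  · rw [signFun_of_gt h hw.2, revSum_odd_of_gt hn hη (by nlinarith) (by nlinarith [hw.2])]

theorem iterate_backRot_of_lt (j : ℕ) {y : ℝ} (hη : η < 1) (hy : y + j * (1 - η) < 1) :
    (backRot η)^[j] y = y + j * (1 - η) := by
  induction j with
  | zero => simp
  | succ j ih =>
    push_cast at hy
    rw [Function.iterate_succ_apply', ih (by linarith), backRot, if_pos (by linarith)]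
    push_cast; ring

theorem birkhoffSum_backRot_of_lt {g : ℝ → ℤ} (hη : η < 1)
    (hg : ∀ y, 0 ≤ y → y < η → g y = 0) (j : ℕ) {y : ℝ} (h0 : 0 ≤ y)
    (hy : y + j * (1 - η) < 1) : birkhoffSum (backRot η) g j y = 0 := by
  induction j with
  | zero => simp
  | succ j ih =>
    have hj : 0 ≤ (j : ℝ) * (1 - η) := mul_nonneg j.cast_nonneg (by linarith)
    push_cast at hy
    rw [birkhoffSum_succ, ih (by linarith), iterate_backRot_of_lt j hη (by linarith),
      hg _ (by linarith) (by linarith), add_zero]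

/-- One step leads from `[η,1)` into `[0,1 - η)`; from there the point climbs in steps of `1 - η`
through `[0,η)`, where the sums vanish. As `η / (1 - η) = b + ζ`, it returns at `w - ζ` mod 1. -/
theorem isInduced_odd (hn : 1 ≤ n) (hη : η ∈ Set.Ioo (0 : ℝ) 1) (hζ : ζ ∈ Set.Ioo (0 : ℝ) 1)
    (hηξ : η * (1 + ξ) = 1) (hξ : ξ * (b + ζ) = 1) :
    IsInduced (backRot η) (revSum (2 * n + 1) η) (rot (1 - ζ)) signFun
      (fun w => η + (1 - η) * w) (Set.Ico 0 1) (fun w => b + 1 - ⌊w + (1 - ζ)⌋₊ + 1) := by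
  have hη0 := hη.1
  have hη1 := hη.2
  have hηζ : (1 - η) * (b + ζ) = η := by
    have : 1 - η = η * ξ := by linarith
    rw [this, mul_assoc, hξ, mul_one]
  have first : ∀ w ∈ Set.Ico (0 : ℝ) 1, backRot η (η + (1 - η) * w) = (1 - η) * w := by
    intro w hw
    have : 0 ≤ (1 - η) * w := mul_nonneg (by linarith) hw.1
    rw [backRot, if_neg (by linarith)]
    ring
  have hfl : ∀ w ∈ Set.Ico (0 : ℝ) 1, ⌊w + (1 - ζ)⌋₊ ≤ b + 1 := by
    intro w hw
    have : ⌊w + (1 - ζ)⌋₊ < 2 := by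
      rw [Nat.floor_lt (by linarith [hw.1, hζ.2])]
      push_cast
      linarith [hw.2, hζ.1]
    omega
  have key : ∀ w ∈ Set.Ico (0 : ℝ) 1,
      (1 - η) * w + ((b + 1 - ⌊w + (1 - ζ)⌋₊ : ℕ) : ℝ) * (1 - η) =
        η + (1 - η) * rot (1 - ζ) w := by
    intro w hw
    have hf : ((⌊w + (1 - ζ)⌋₊ : ℕ) : ℝ) = (⌊w + (1 - ζ)⌋ : ℝ) :=
      natCast_floor_eq_intCast_floor (by linarith [hw.1, hζ.2])
    rw [Nat.cast_sub (hfl w hw), hf, rot, Int.fract]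
    push_cast
    linear_combination hηζ
  have hlt : ∀ w ∈ Set.Ico (0 : ℝ) 1,
      (1 - η) * w + ((b + 1 - ⌊w + (1 - ζ)⌋₊ : ℕ) : ℝ) * (1 - η) < 1 := by
    intro w hw
    rw [key w hw]
    nlinarith [(rot_mem_Ico (1 - ζ) w).2]
  have sums : ∀ w ∈ Set.Ico (0 : ℝ) 1, ∀ m ≤ b + 1 - ⌊w + (1 - ζ)⌋₊,
      birkhoffSum (backRot η) (revSum (2 * n + 1) η) (m + 1) (η + (1 - η) * w) = signFun w := by
    intro w hw m hm
    have hm' : (m : ℝ) ≤ ((b + 1 - ⌊w + (1 - ζ)⌋₊ : ℕ) : ℝ) := by exact_mod_cast hm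
    rw [birkhoffSum_succ', first w hw, birkhoffSum_backRot_of_lt hη1
      (fun y hy hy' => revSum_odd_of_lt hη hy hy') m (mul_nonneg (by linarith) hw.1)
      (by nlinarith [hlt w hw]), revSum_odd_affine hn hη hw, add_zero]
  refine ⟨fun w _ => by simp, fun w _ => rot_mem_Ico _ w, fun w hw => ?_,
    fun w hw => sums w hw _ le_rfl, fun w hw m hm => ?_⟩
  · rw [Function.iterate_succ_apply, first w hw, iterate_backRot_of_lt _ hη1 (hlt w hw), key w hw]
  · rcases m with _ | m
    · simp
    · rw [sums w hw m (by omega)]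
      exact min_le_right _ _

theorem exists_of_heavy_backRot_odd_of_ge (hn : 1 ≤ n) (hη : η ∈ Set.Ioo (0 : ℝ) 1)
    (hζ : ζ ∈ Set.Ioo (0 : ℝ) 1) (hηξ : η * (1 + ξ) = 1) (hξ : ξ * (b + ζ) = 1) {y : ℝ}
    (hy : η ≤ y) (hy1 : y < 1) (hh : Heavy (backRot η) (revSum (2 * n + 1) η) y) :
    ∃ w ∈ heavySet (1 - ζ), y = η + (1 - η) * w := by
  have h1 : 0 < 1 - η := by linarith [hη.2]
  have e : η + (1 - η) * ((y - η) / (1 - η)) = y := by field_simp; ring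
  have hw : (y - η) / (1 - η) ∈ Set.Ico (0 : ℝ) 1 :=
    ⟨div_nonneg (by linarith) h1.le, by rw [div_lt_one h1]; linarith⟩
  refine ⟨(y - η) / (1 - η), mem_heavySet_iff.2 ⟨hw, ?_⟩, e.symm⟩
  exact (isInduced_odd hn hη hζ hηξ hξ).heavy_of_heavy hw (by simpa only [e] using hh)

theorem exists_of_heavy_backRot_odd (hn : 1 ≤ n) (hη : η ∈ Set.Ioo (0 : ℝ) 1)
    (hζ : ζ ∈ Set.Ioo (0 : ℝ) 1) (hηξ : η * (1 + ξ) = 1) (hξ : ξ * (b + ζ) = 1) (k : ℕ) {y : ℝ}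
    (hy : y ∈ Set.Ico (0 : ℝ) 1) (hk : η - k * (1 - η) ≤ y)
    (hh : Heavy (backRot η) (revSum (2 * n + 1) η) y) :
    ∃ j ≤ k, ∃ w ∈ heavySet (1 - ζ), y = η + (1 - η) * (w - j) := by
  induction k generalizing y with
  | zero =>
    obtain ⟨w, hw, e⟩ :=
      exists_of_heavy_backRot_odd_of_ge hn hη hζ hηξ hξ (by simpa using hk) hy.2 hh
    exact ⟨0, le_rfl, w, hw, by simpa using e⟩
  | succ k ih =>
    rcases lt_or_ge y η with h | h
    · have e : backRot η y = y + 1 - η := if_pos h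
      rw [← heavy_apply_iff (revSum_odd_of_lt hη hy.1 h)] at hh
      obtain ⟨j, hj, w, hw, e'⟩ := ih (backRot_mem_Ico hη hy)
        (by rw [e]; push_cast at hk; linarith) hh
      refine ⟨j + 1, by omega, w, hw, ?_⟩
      push_cast
      linarith
    · obtain ⟨w, hw, e⟩ := exists_of_heavy_backRot_odd_of_ge hn hη hζ hηξ hξ h hy.2 hh
      exact ⟨0, by omega, w, hw, by simpa using e⟩

/-- If the first partial quotient is odd and the second one is `1`, every heavy point is an affine
image of a heavy point of a rotation further along the Gauss map. -/
theorem exists_of_mem_heavySet_odd (hn : 1 ≤ n) (h0 : 0 < θ)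
    (hθ : θ * ((2 * n + 1 : ℕ) + η) = 1) (hη : η ∈ Set.Ioo (0 : ℝ) 1)
    (hζ : ζ ∈ Set.Ioo (0 : ℝ) 1) (hηξ : η * (1 + ξ) = 1) (hξ : ξ * (b + ζ) = 1) {x : ℝ}
    (hx : x ∈ heavySet θ) :
    ∃ w ∈ heavySet (1 - ζ), x = θ * (1 + η) + θ * (1 - η) * w ∨
      ∃ j ≤ b + 1, x = θ * (η - (1 - η) * j) + θ * (1 - η) * w := by
  obtain ⟨y, hy, ⟨rfl, hh⟩ | ⟨rfl, h1, hh⟩⟩ :=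
    (mem_heavySet_iff_revolution hθ h0 (by omega) hη).1 hx
  · have hk : η - (b + 1 : ℕ) * (1 - η) ≤ y := by
      have hηζ : (1 - η) * (b + ζ) = η := by
        have : 1 - η = η * ξ := by linarith
        rw [this, mul_assoc, hξ, mul_one]
      push_cast
      nlinarith [hη.2, hζ.2, hy.1]
    obtain ⟨j, hj, w, hw, e⟩ := exists_of_heavy_backRot_odd hn hη hζ hηξ hξ (b + 1) hy hk hh
    exact ⟨w, hw, Or.inr ⟨j, hj, by rw [e]; ring⟩⟩
  · have hy' : η ≤ y := by
      by_contra! hc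
      rw [revSum_odd_of_lt hη hy.1 hc] at h1
      omega
    have hhy : Heavy (backRot η) (revSum (2 * n + 1) η) y := by
      refine heavy_of_iterate (k := 1) (fun m hm => ?_) hh
      interval_cases m <;> simp [h1]
    obtain ⟨w, hw, e⟩ := exists_of_heavy_backRot_odd_of_ge hn hη hζ hηξ hξ hy' hy.2 hhy
    exact ⟨w, hw, Or.inl (by rw [e]; ring)⟩

end Odd

/-! ### Hausdorff dimension from scaled copies -/

section Dimension

open Filter Topology MeasureTheory
open scoped NNReal ENNReal

/-- Finitely many factors above 1 cost only a constant; thus both dimension bounds need their ratio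
condition only eventually. -/
theorem exists_prod_range_le {r : ℕ → ℝ} (h0 : ∀ k, 0 ≤ r k) (h : ∀ᶠ k in atTop, r k ≤ 1) :
    ∃ C : ℝ, 0 < C ∧ ∀ K, ∏ i ∈ Finset.range K, r i ≤ C := by
  obtain ⟨k₀, hk₀⟩ := eventually_atTop.1 h
  have h1 : ∀ i, 1 ≤ max 1 (r i) := fun i => le_max_left _ _
  refine ⟨∏ i ∈ Finset.range k₀, max 1 (r i),
    Finset.prod_pos fun i _ => zero_lt_one.trans_le (h1 i), fun K => ?_⟩
  refine (Finset.prod_le_prod (fun i _ => h0 i) fun i _ => le_max_right 1 (r i)).trans ?_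
  induction K with
  | zero => simpa using Finset.one_le_prod (s := Finset.range k₀) fun i _ => h1 i
  | succ K ih =>
    rcases lt_or_ge K k₀ with hK | hK
    · exact Finset.prod_le_prod_of_subset_of_one_le (Finset.range_subset_range.2 hK)
        (fun i _ => zero_le_one.trans (h1 i)) (fun i _ _ => h1 i)
    · rw [Finset.prod_range_succ, max_eq_left (hk₀ K hK), mul_one]
      exact ih

theorem exists_finset_cover {H : ℕ → Set ℝ} {N : ℕ → ℕ} {c : ℕ → ℝ}
    (hH : ∀ k, H k ⊆ Set.Icc 0 1) (hc0 : ∀ k, 0 < c k)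
    (hstep : ∀ k, ∃ φ : ℕ → ℝ, ∀ x ∈ H k, ∃ i < N k, ∃ y ∈ H (k + 1), x = φ i + c k * y)
    (K : ℕ) : ∀ k, ∃ F : Finset ℝ, F.card ≤ ∏ i ∈ Finset.range K, N (k + i) ∧
      ∀ x ∈ H k, ∃ p ∈ F, |x - p| ≤ ∏ i ∈ Finset.range K, c (k + i) := by
  induction K with
  | zero =>
    refine fun k => ⟨{0}, by simp, fun x hx => ⟨0, by simp, ?_⟩⟩
    obtain ⟨h0, h1⟩ := hH k hx
    simpa [abs_of_nonneg h0] using h1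
  | succ K ih =>
    intro k
    obtain ⟨F, hF, hcov⟩ := ih (k + 1)
    obtain ⟨φ, hφ⟩ := hstep k
    refine ⟨(Finset.range (N k) ×ˢ F).image fun q => φ q.1 + c k * q.2, ?_, fun x hx => ?_⟩
    · refine Finset.card_image_le.trans ?_
      rw [Finset.card_product, Finset.card_range, Finset.prod_range_succ', mul_comm]
      simpa only [add_assoc, add_comm 1, add_zero] using Nat.mul_le_mul_right (N k) hF
    · obtain ⟨i, hi, y, hy, rfl⟩ := hφ x hx
      obtain ⟨p, hp, hyp⟩ := hcov y hy
      refine ⟨φ i + c k * p, Finset.mem_image.2 ⟨(i, p), by simp [hi, hp], rfl⟩, ?_⟩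
      rw [add_sub_add_left_eq_sub, ← mul_sub, abs_mul, abs_of_pos (hc0 k),
        Finset.prod_range_succ', mul_comm]
      simpa only [add_assoc, add_comm 1, add_zero] using
        mul_le_mul_of_nonneg_right hyp (hc0 k).le

/-- An upper bound for the dimension of a set that is covered, again and again, by `N k` translates
of a copy of the next set scaled by `c k`. -/
theorem dimH_le_of_scaled_covers {H : ℕ → Set ℝ} {N : ℕ → ℕ} {c : ℕ → ℝ} {d : ℝ≥0}
    (hH : ∀ k, H k ⊆ Set.Icc 0 1) (hc0 : ∀ k, 0 < c k) (hc : ∀ k, c k ≤ 1 / 2)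
    (hstep : ∀ k, ∃ φ : ℕ → ℝ, ∀ x ∈ H k, ∃ i < N k, ∃ y ∈ H (k + 1), x = φ i + c k * y)
    (hd : ∀ᶠ k in atTop, N k * c k ^ (d : ℝ) ≤ 1) : dimH (H 0) ≤ d := by
  obtain ⟨C, hC, hprod⟩ := exists_prod_range_le
    (fun k => mul_nonneg (N k).cast_nonneg (Real.rpow_nonneg (hc0 k).le d)) hd
  choose F hF hcov using fun K => exists_finset_cover hH hc0 hstep K 0
  simp only [zero_add] at hF hcov
  set δ : ℕ → ℝ := fun K => ∏ i ∈ Finset.range K, c i with hδ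
  have hδ0 : ∀ K, 0 < δ K := fun K => Finset.prod_pos fun i _ => hc0 i
  have hδle : ∀ K, δ K ≤ (1 / 2) ^ K := fun K => by
    simpa using Finset.prod_le_prod (s := Finset.range K) (fun i _ => (hc0 i).le) fun i _ => hc i
  have hδlim : Tendsto δ atTop (𝓝 0) :=
    squeeze_zero (fun K => (hδ0 K).le) hδle
      (tendsto_pow_atTop_nhds_zero_of_lt_one (by norm_num) (by norm_num))
  have hr : Tendsto (fun K => ENNReal.ofReal (2 * δ K)) atTop (𝓝 0) := by
    have := ENNReal.tendsto_ofReal (hδlim.const_mul 2)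
    simpa using this
  have hdiam : ∀ K (p : F K),
      Metric.ediam (Metric.closedBall (p : ℝ) (δ K)) ≤ ENNReal.ofReal (2 * δ K) := fun K p => by
    rw [Real.closedBall_eq_Icc, Real.ediam_Icc]
    exact ENNReal.ofReal_le_ofReal (by linarith)
  have hsum : ∀ K, ∑ p : F K, Metric.ediam (Metric.closedBall (p : ℝ) (δ K)) ^ (d : ℝ) ≤
      ENNReal.ofReal (2 ^ (d : ℝ) * C) := by
    intro K
    calc ∑ p : F K, Metric.ediam (Metric.closedBall (p : ℝ) (δ K)) ^ (d : ℝ)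
        ≤ ∑ _p : F K, ENNReal.ofReal ((2 * δ K) ^ (d : ℝ)) := by
          refine Finset.sum_le_sum fun p _ => ?_
          rw [← ENNReal.ofReal_rpow_of_nonneg (by linarith [hδ0 K]) d.coe_nonneg]
          exact ENNReal.rpow_le_rpow (hdiam K p) d.coe_nonneg
      _ = ENNReal.ofReal ((F K).card * (2 * δ K) ^ (d : ℝ)) := by
          rw [Finset.sum_const, Finset.card_univ, Fintype.card_coe, nsmul_eq_mul,
            ENNReal.ofReal_mul (Nat.cast_nonneg _), ENNReal.ofReal_natCast]
      _ ≤ ENNReal.ofReal (2 ^ (d : ℝ) * C) := by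
          refine ENNReal.ofReal_le_ofReal ?_
          rw [Real.mul_rpow (by norm_num) (hδ0 K).le]
          have h1 : ((F K).card : ℝ) ≤ ∏ i ∈ Finset.range K, (N i : ℝ) := by exact_mod_cast hF K
          have h2 : δ K ^ (d : ℝ) = ∏ i ∈ Finset.range K, c i ^ (d : ℝ) :=
            (Real.finsetProd_rpow _ _ (fun i _ => (hc0 i).le) _).symm
          have h3 := hprod K
          rw [Finset.prod_mul_distrib, ← h2] at h3
          have h4 : 0 ≤ δ K ^ (d : ℝ) := Real.rpow_nonneg (hδ0 K).le _
          have h5 : (0 : ℝ) ≤ 2 ^ (d : ℝ) := by positivity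
          calc ((F K).card : ℝ) * (2 ^ (d : ℝ) * δ K ^ (d : ℝ))
              = 2 ^ (d : ℝ) * ((F K).card * δ K ^ (d : ℝ)) := by ring
            _ ≤ 2 ^ (d : ℝ) * C :=
                mul_le_mul_of_nonneg_left ((mul_le_mul_of_nonneg_right h1 h4).trans h3) h5
  have hμ : μH[d] (H 0) ≤ ENNReal.ofReal (2 ^ (d : ℝ) * C) := by
    refine (Measure.hausdorffMeasure_le_liminf_sum (ι := fun K => F K) (d : ℝ) (H 0) _ hr
      (fun K p => Metric.closedBall (p : ℝ) (δ K)) (Eventually.of_forall hdiam)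
      (Eventually.of_forall fun K x hx => ?_)).trans ?_
    · obtain ⟨p, hp, h⟩ := hcov K x hx
      exact Set.mem_iUnion.2 ⟨⟨p, hp⟩, by simpa [Real.dist_eq] using h⟩
    · refine (liminf_le_liminf (Eventually.of_forall hsum)).trans ?_
      simp
  exact dimH_le_of_hausdorffMeasure_ne_top (ne_top_of_le_ne_top ENNReal.ofReal_ne_top hμ)

/-! ### Coding by doubled mixed radix digits -/

section Coding

variable {m : ℕ → ℕ} {c : ℕ → ℝ}

/-- The point whose first `n` digits (from level `k` on) are twice the mixed radix digits of `t`,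
and whose further digits are zero. -/
def digitApprox (m : ℕ → ℕ) (c : ℕ → ℝ) : ℕ → ℕ → ℝ → ℝ
  | 0, _, _ => 0
  | n + 1, k, t =>
    c k * (2 * ⌊m k * t⌋₊ + digitApprox m c n (k + 1) (Int.fract (m k * t)))

/-- The point with digits twice the mixed radix digits of `t`. -/
def digitPoint (m : ℕ → ℕ) (c : ℕ → ℝ) (k : ℕ) (t : ℝ) : ℝ := ⨆ n, digitApprox m c n k t

theorem floor_mul_add_one_le {n : ℕ} (hn : 1 ≤ n) {t : ℝ} (ht : t ∈ Set.Ico (0 : ℝ) 1) :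
    ⌊n * t⌋₊ + 1 ≤ n := by
  have hn' : (0 : ℝ) < n := by exact_mod_cast hn
  rw [Nat.succ_le_iff, Nat.floor_lt (mul_nonneg hn'.le ht.1)]
  nlinarith [ht.2]

theorem mul_digit_add_mem_Ico (hm : ∀ k, 1 ≤ m k) (hc0 : ∀ k, 0 < c k)
    (hmc : ∀ k, 2 * m k * c k ≤ 1) (k : ℕ) {t y : ℝ} (ht : t ∈ Set.Ico (0 : ℝ) 1) (hy0 : 0 ≤ y)
    (hy : y ≤ 1) : c k * (2 * ⌊m k * t⌋₊ + y) ∈ Set.Ico (0 : ℝ) 1 := by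
  have h : ((⌊m k * t⌋₊ : ℕ) : ℝ) + 1 ≤ m k := by exact_mod_cast floor_mul_add_one_le (hm k) ht
  refine ⟨mul_nonneg (hc0 k).le (by positivity), ?_⟩
  nlinarith [hc0 k, hmc k]

theorem fract_mem_Ico (x : ℝ) : Int.fract x ∈ Set.Ico (0 : ℝ) 1 :=
  ⟨Int.fract_nonneg _, Int.fract_lt_one _⟩

theorem digitApprox_mem_Ico (hm : ∀ k, 1 ≤ m k) (hc0 : ∀ k, 0 < c k)
    (hmc : ∀ k, 2 * m k * c k ≤ 1) (n : ℕ) : ∀ k, ∀ t ∈ Set.Ico (0 : ℝ) 1,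
      digitApprox m c n k t ∈ Set.Ico (0 : ℝ) 1 := by
  induction n with
  | zero => intro k t _; simp [digitApprox]
  | succ n ih =>
    intro k t ht
    have := ih (k + 1) _ (fract_mem_Ico (m k * t))
    exact mul_digit_add_mem_Ico hm hc0 hmc k ht this.1 this.2.le

theorem digitApprox_le_succ (hm : ∀ k, 1 ≤ m k) (hc0 : ∀ k, 0 < c k)
    (hmc : ∀ k, 2 * m k * c k ≤ 1) (n : ℕ) : ∀ k, ∀ t ∈ Set.Ico (0 : ℝ) 1,
      digitApprox m c n k t ≤ digitApprox m c (n + 1) k t := by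
  induction n with
  | zero => exact fun k t ht => (digitApprox_mem_Ico hm hc0 hmc 1 k t ht).1
  | succ n ih =>
    intro k t _
    have := ih (k + 1) _ (fract_mem_Ico (m k * t))
    rw [digitApprox, digitApprox]
    exact mul_le_mul_of_nonneg_left (by linarith) (hc0 k).le

theorem tendsto_digitApprox (hm : ∀ k, 1 ≤ m k) (hc0 : ∀ k, 0 < c k)
    (hmc : ∀ k, 2 * m k * c k ≤ 1) (k : ℕ) {t : ℝ} (ht : t ∈ Set.Ico (0 : ℝ) 1) :
    Tendsto (fun n => digitApprox m c n k t) atTop (𝓝 (digitPoint m c k t)) :=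
  tendsto_atTop_ciSup
    (monotone_nat_of_le_succ fun n => digitApprox_le_succ hm hc0 hmc n k t ht)
    ⟨1, Set.forall_mem_range.2 fun n => (digitApprox_mem_Ico hm hc0 hmc n k t ht).2.le⟩

theorem digitPoint_eq (hm : ∀ k, 1 ≤ m k) (hc0 : ∀ k, 0 < c k)
    (hmc : ∀ k, 2 * m k * c k ≤ 1) (k : ℕ) {t : ℝ} (ht : t ∈ Set.Ico (0 : ℝ) 1) :
    digitPoint m c k t =
      c k * (2 * ⌊m k * t⌋₊ + digitPoint m c (k + 1) (Int.fract (m k * t))) :=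
  tendsto_nhds_unique ((tendsto_digitApprox hm hc0 hmc k ht).comp (tendsto_add_atTop_nat 1))
    (((tendsto_digitApprox hm hc0 hmc (k + 1) (fract_mem_Ico (m k * t))).const_add _).const_mul _)

theorem digitPoint_mem_Ico (hm : ∀ k, 1 ≤ m k) (hc0 : ∀ k, 0 < c k)
    (hmc : ∀ k, 2 * m k * c k ≤ 1) (k : ℕ) {t : ℝ} (ht : t ∈ Set.Ico (0 : ℝ) 1) :
    digitPoint m c k t ∈ Set.Ico (0 : ℝ) 1 := by
  have h := isClosed_Icc.mem_of_tendsto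
    (tendsto_digitApprox hm hc0 hmc (k + 1) (fract_mem_Ico (m k * t)))
    (Eventually.of_forall fun n =>
      Set.Ico_subset_Icc_self (digitApprox_mem_Ico hm hc0 hmc n _ _ (fract_mem_Ico (m k * t))))
  rw [digitPoint_eq hm hc0 hmc k ht]
  exact mul_digit_add_mem_Ico hm hc0 hmc k ht h.1 h.2

/-- Distinct digits differ by at least 2 after doubling, while the remainders lie in `[0,1)`, so a
gap of one full cell remains. -/
theorem scale_le_sub_of_floor_lt (hm : ∀ k, 1 ≤ m k) (hc0 : ∀ k, 0 < c k)
    (hmc : ∀ k, 2 * m k * c k ≤ 1) (k : ℕ) {t u : ℝ} (ht : t ∈ Set.Ico (0 : ℝ) 1)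
    (hu : u ∈ Set.Ico (0 : ℝ) 1) (h : ⌊m k * t⌋₊ < ⌊m k * u⌋₊) :
    c k ≤ digitPoint m c k u - digitPoint m c k t := by
  have h' : ((⌊m k * t⌋₊ : ℕ) : ℝ) + 1 ≤ ⌊m k * u⌋₊ := by exact_mod_cast h
  have h1 := digitPoint_mem_Ico hm hc0 hmc (k + 1) (fract_mem_Ico (m k * t))
  have h2 := digitPoint_mem_Ico hm hc0 hmc (k + 1) (fract_mem_Ico (m k * u))
  rw [digitPoint_eq hm hc0 hmc k ht, digitPoint_eq hm hc0 hmc k hu, ← mul_sub]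
  exact le_mul_of_one_le_right (hc0 k).le (by linarith [h1.2, h2.1])

/-- Two parameters that are at distance more than `1 / (m k ⋯ m (k + n - 1))` have coded points
that are separated at one of the first `n` levels. -/
theorem exists_level (hm : ∀ k, 1 ≤ m k) (hc0 : ∀ k, 0 < c k)
    (hmc : ∀ k, 2 * m k * c k ≤ 1) (n : ℕ) : ∀ k, ∀ t ∈ Set.Ico (0 : ℝ) 1,
      ∀ u ∈ Set.Ico (0 : ℝ) 1, 1 ≤ |t - u| * ∏ i ∈ Finset.range n, (m (k + i) : ℝ) →
      ∃ j, |t - u| * ∏ i ∈ Finset.range j, (m (k + i) : ℝ) ≤ 1 ∧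
        ∏ i ∈ Finset.range (j + 1), c (k + i) ≤ |digitPoint m c k t - digitPoint m c k u| := by
  induction n with
  | zero =>
    intro k t ht u hu h
    exfalso
    have : |t - u| < 1 := abs_lt.2 ⟨by linarith [ht.1, hu.2], by linarith [ht.2, hu.1]⟩
    simp at h
    linarith
  | succ n ih =>
    intro k t ht u hu h
    have hlt : |t - u| ≤ 1 := (abs_lt.2 ⟨by linarith [ht.1, hu.2], by linarith [ht.2, hu.1]⟩).le
    rcases lt_trichotomy ⌊m k * t⌋₊ ⌊m k * u⌋₊ with hd | hd | hd
    · refine ⟨0, by simpa using hlt, ?_⟩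
      rw [abs_sub_comm]
      simpa using (scale_le_sub_of_floor_lt hm hc0 hmc k ht hu hd).trans (le_abs_self _)
    · have hm0 : (0 : ℝ) ≤ m k := Nat.cast_nonneg _
      have e : Int.fract (m k * t) - Int.fract (m k * u) = m k * (t - u) := by
        have h1 := natCast_floor_eq_intCast_floor (R := ℝ) (mul_nonneg hm0 ht.1)
        have h2 := natCast_floor_eq_intCast_floor (R := ℝ) (mul_nonneg hm0 hu.1)
        rw [Int.fract, Int.fract, ← h1, ← h2, hd]
        ring
      have hP : ∀ i, |Int.fract (m k * t) - Int.fract (m k * u)| *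
          ∏ i ∈ Finset.range i, (m (k + 1 + i) : ℝ) =
          |t - u| * ∏ i ∈ Finset.range (i + 1), (m (k + i) : ℝ) := by
        intro i
        rw [e, abs_mul, abs_of_nonneg hm0, Finset.prod_range_succ']
        simp only [add_assoc, add_comm 1, add_zero]
        ring
      obtain ⟨j, hj1, hj2⟩ := ih (k + 1) _ (fract_mem_Ico (m k * t)) _ (fract_mem_Ico (m k * u))
        (by rw [hP]; exact h)
      refine ⟨j + 1, by rw [← hP]; exact hj1, ?_⟩
      rw [digitPoint_eq hm hc0 hmc k ht, digitPoint_eq hm hc0 hmc k hu, hd, ← mul_sub,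
        add_sub_add_left_eq_sub, abs_mul, abs_of_pos (hc0 k), Finset.prod_range_succ', mul_comm]
      simpa only [add_assoc, add_comm 1, add_zero] using
        mul_le_mul_of_nonneg_left hj2 (hc0 k).le
    · refine ⟨0, by simpa using hlt, ?_⟩
      simpa using (scale_le_sub_of_floor_lt hm hc0 hmc k hu ht hd).trans (le_abs_self _)

/-- This is Hölder continuity of the inverse coding. At the level `j` of separation the parameters
differ by at most `1 / (m 0 ⋯ m (j - 1))` and the points by at least `c 0 ⋯ c j`. The one extra
factor explains why `m k` is compared with `c (k + 1)` and why `c 0` enters the constant. -/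
theorem exists_abs_sub_le_rpow (hm : ∀ k, 2 ≤ m k) (hc0 : ∀ k, 0 < c k)
    (hmc : ∀ k, 2 * m k * c k ≤ 1) {s : ℝ} (hs : 0 ≤ s)
    (h : ∀ᶠ k in atTop, 1 ≤ m k * c (k + 1) ^ s) :
    ∃ C : ℝ, 0 < C ∧ ∀ t ∈ Set.Ico (0 : ℝ) 1, ∀ u ∈ Set.Ico (0 : ℝ) 1,
      |t - u| ≤ C * |digitPoint m c 0 t - digitPoint m c 0 u| ^ s := by
  have hm1 : ∀ k, 1 ≤ m k := fun k => by have := hm k; omega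
  have hmpos : ∀ k, (0 : ℝ) < m k := fun k => by exact_mod_cast hm1 k
  have hcs : ∀ k, 0 < c k ^ s := fun k => Real.rpow_pos_of_pos (hc0 k) s
  obtain ⟨C, hC, hprod⟩ := exists_prod_range_le (r := fun k => (m k * c (k + 1) ^ s)⁻¹)
    (fun k => (inv_pos.2 (mul_pos (hmpos k) (hcs _))).le)
    (h.mono fun k hk => inv_le_one_of_one_le₀ hk)
  refine ⟨C / c 0 ^ s, div_pos hC (hcs 0), fun t ht u hu => ?_⟩
  rcases eq_or_ne t u with rfl | htu
  · simp only [sub_self, abs_zero]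
    exact mul_nonneg (div_pos hC (hcs 0)).le (Real.rpow_nonneg le_rfl s)
  have hpos : 0 < |t - u| := abs_pos.2 (sub_ne_zero.2 htu)
  obtain ⟨n, hn⟩ := pow_unbounded_of_one_lt (1 / |t - u|) (one_lt_two : (1 : ℝ) < 2)
  have hn' : 1 ≤ |t - u| * ∏ i ∈ Finset.range n, (m (0 + i) : ℝ) := by
    have h1 : (2 : ℝ) ^ n ≤ ∏ i ∈ Finset.range n, (m (0 + i) : ℝ) := by
      simpa using Finset.prod_le_prod (s := Finset.range n) (f := fun _ => (2 : ℝ))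
        (g := fun i => (m (0 + i) : ℝ)) (fun _ _ => by norm_num)
        (fun i _ => by exact_mod_cast hm (0 + i))
    rw [div_lt_iff₀ hpos] at hn
    nlinarith
  obtain ⟨j, hj1, hj2⟩ := exists_level hm1 hc0 hmc n 0 t ht u hu hn'
  simp only [zero_add] at hj1 hj2
  have hM : 0 < ∏ i ∈ Finset.range j, (m i : ℝ) := Finset.prod_pos fun i _ => hmpos i
  have hL : 0 < ∏ i ∈ Finset.range (j + 1), c i := Finset.prod_pos fun i _ => hc0 i
  have hLs : (∏ i ∈ Finset.range (j + 1), c i) ^ s =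
      (∏ i ∈ Finset.range j, c (i + 1) ^ s) * c 0 ^ s := by
    rw [← Real.finsetProd_rpow _ _ fun i _ => (hc0 i).le, Finset.prod_range_succ']
  have hp := hprod j
  rw [Finset.prod_inv_distrib, Finset.prod_mul_distrib] at hp
  have hQ : 0 < ∏ i ∈ Finset.range j, c (i + 1) ^ s := Finset.prod_pos fun i _ => hcs (i + 1)
  calc |t - u| ≤ (∏ i ∈ Finset.range j, (m i : ℝ))⁻¹ := by
        rw [← one_div, le_div_iff₀ hM]; exact hj1
    _ = ((∏ i ∈ Finset.range j, (m i : ℝ)) * ∏ i ∈ Finset.range j, c (i + 1) ^ s)⁻¹ *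
          ∏ i ∈ Finset.range j, c (i + 1) ^ s := by field_simp
    _ ≤ C * ∏ i ∈ Finset.range j, c (i + 1) ^ s := mul_le_mul_of_nonneg_right hp hQ.le
    _ = C / c 0 ^ s * (∏ i ∈ Finset.range (j + 1), c i) ^ s := by
        rw [hLs]; have := (hcs 0).ne'; field_simp
    _ ≤ C / c 0 ^ s * |digitPoint m c 0 t - digitPoint m c 0 u| ^ s :=
        mul_le_mul_of_nonneg_left (Real.rpow_le_rpow hL.le hj2 hs) (div_pos hC (hcs 0)).le

/-- A lower bound for the dimension of the set of points coded by mixed radix digits. -/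
theorem le_dimH_image_digitPoint (hm : ∀ k, 2 ≤ m k) (hc0 : ∀ k, 0 < c k)
    (hmc : ∀ k, 2 * m k * c k ≤ 1) {s : ℝ≥0} (hs : 0 < s)
    (h : ∀ᶠ k in atTop, 1 ≤ m k * c (k + 1) ^ (s : ℝ)) :
    (s : ℝ≥0∞) ≤ dimH (digitPoint m c 0 '' Set.Ico 0 1) := by
  obtain ⟨C, hC, hle⟩ := exists_abs_sub_le_rpow hm hc0 hmc s.coe_nonneg h
  set X := digitPoint m c 0
  have hinv : Set.InjOn X (Set.Ico 0 1) := by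
    intro t ht u hu htu
    have := hle t ht u hu
    rw [htu, sub_self, abs_zero, Real.zero_rpow (NNReal.coe_pos.2 hs).ne', mul_zero] at this
    exact sub_eq_zero.1 (abs_nonpos_iff.1 this)
  have hleft := hinv.leftInvOn_invFunOn
  have himg : Function.invFunOn X (Set.Ico 0 1) '' (X '' Set.Ico 0 1) = Set.Ico 0 1 :=
    hleft.image_image
  have hholder : HolderOnWith C.toNNReal s (Function.invFunOn X (Set.Ico 0 1))
      (X '' Set.Ico 0 1) := by
    rintro _ ⟨t, ht, rfl⟩ _ ⟨u, hu, rfl⟩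
    rw [hleft ht, hleft hu, edist_dist, edist_dist, Real.dist_eq, Real.dist_eq,
      ENNReal.ofReal_rpow_of_nonneg (abs_nonneg _) s.coe_nonneg, ← ENNReal.ofReal,
      ← ENNReal.ofReal_mul hC.le]
    exact ENNReal.ofReal_le_ofReal (hle t ht u hu)
  have hdim := hholder.dimH_image_le hs
  have h1 : dimH (Set.Ico (0 : ℝ) 1) = 1 := by
    rw [Real.dimH_of_nonempty_interior (by simp)]
    simp
  rw [himg, h1, ENNReal.le_div_iff_mul_le (Or.inl (by exact_mod_cast hs.ne'))
    (Or.inl ENNReal.coe_ne_top), one_mul] at hdim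
  exact hdim

end Coding

end Dimension

/-! ### Lambert's continued fraction of `tanh (1/2)` -/

section ContFrac

open Nat

theorem hasContFrac_of_inv_eq {t : ℕ → ℝ} {a : ℕ → ℕ} (ht : ∀ k, t k ∈ Set.Ioo (0 : ℝ) 1)
    (h : ∀ k, (t k)⁻¹ = a k + t (k + 1)) : HasContFrac (t 0) a := by
  have hfr : ∀ k, Int.fract (t k) = t k := fun k => Int.fract_eq_self.2 ⟨(ht k).1.le, (ht k).2⟩
  have hfl : ∀ k, ⌊(t k)⁻¹⌋ = a k := fun k => by
    rw [h k, Int.floor_eq_iff]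
    push_cast
    exact ⟨by linarith [(ht (k + 1)).1], by linarith [(ht (k + 1)).2]⟩
  -- Only the fractional part of `v` is prescribed, because the induction passes to `(t k)⁻¹`, which
  -- has an integer part.
  have key : ∀ n k v, Int.fract v = t k →
      (GenContFract.of v).s.get? n = some ⟨1, (a (k + n) : ℝ)⟩ := by
    intro n
    induction n with
    | zero =>
      intro k v hv
      have := GenContFract.of_s_head (v := v) (by rw [hv]; exact (ht k).1.ne')
      rw [hv, hfl k] at this
      change (GenContFract.of v).s.get? 0 = _ at this
      simpa using this
    | succ n ih =>
      intro k v hv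
      rw [GenContFract.of_s_succ, hv, ih (k + 1), add_right_comm, add_assoc]
      rw [Int.fract, hfl k, h k]
      push_cast; ring
  refine ⟨?_, fun n => by simpa using key n 0 (t 0) (hfr 0)⟩
  rw [GenContFract.of_h_eq_floor, Int.floor_eq_zero_iff.2 ⟨(ht 0).1.le, (ht 0).2⟩]
  simp

/-- The terms of the series, a rescaled spherical Bessel series at `1/2`, whose ratios give the
continued fraction of `tanh (1/2)`. -/
def lambertTerm (n m : ℕ) : ℝ := (1 / 4) ^ m * (n + m)! / (m ! * (2 * n + 2 * m)!)

/-- The sum of `lambertTerm n`. -/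
def lambertSum (n : ℕ) : ℝ := ∑' m, lambertTerm n m

theorem lambertTerm_pos (n m : ℕ) : 0 < lambertTerm n m := by
  unfold lambertTerm
  positivity

theorem lambertTerm_succ (n m : ℕ) :
    2 * (2 * n + 2 * m + 1) * lambertTerm (n + 1) m = lambertTerm n m := by
  unfold lambertTerm
  have e1 : n + 1 + m = n + m + 1 := by ring
  have e2 : 2 * (n + 1) + 2 * m = 2 * n + 2 * m + 1 + 1 := by ring
  rw [e1, e2, Nat.factorial_succ (n + m), Nat.factorial_succ (2 * n + 2 * m + 1),
    Nat.factorial_succ (2 * n + 2 * m)]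
  push_cast
  field_simp
  ring

theorem lambertTerm_add_two (n m : ℕ) :
    lambertTerm (n + 2) m = 4 * (m + 1) * lambertTerm (n + 1) (m + 1) := by
  unfold lambertTerm
  have e1 : n + 1 + (m + 1) = n + 2 + m := by ring
  have e2 : 2 * (n + 1) + 2 * (m + 1) = 2 * (n + 2) + 2 * m := by ring
  rw [e1, e2, Nat.factorial_succ m, pow_succ]
  push_cast
  field_simp

theorem hasSum_lambertTerm_zero : HasSum (lambertTerm 0) (Real.cosh (1 / 2)) := by
  convert! Real.hasSum_cosh (1 / 2) using 2 with m
  unfold lambertTerm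
  rw [pow_mul, show ((1 : ℝ) / 2) ^ 2 = 1 / 4 by norm_num]
  simp only [zero_add, mul_zero]
  field_simp

theorem hasSum_lambertTerm_one : HasSum (lambertTerm 1) (Real.sinh (1 / 2)) := by
  convert! Real.hasSum_sinh (1 / 2) using 2 with m
  have h := lambertTerm_succ 0 m
  have h' : lambertTerm 1 m = lambertTerm 0 m / (2 * (2 * m + 1)) := by
    rw [← h]; push_cast; field_simp; ring
  rw [h', lambertTerm, pow_succ, pow_mul, show ((1 : ℝ) / 2) ^ 2 = 1 / 4 by norm_num,
    Nat.factorial_succ]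
  simp only [zero_add, mul_zero]
  push_cast
  field_simp

theorem summable_lambertTerm (n : ℕ) : Summable (lambertTerm n) := by
  induction n with
  | zero => exact hasSum_lambertTerm_zero.summable
  | succ n ih =>
    refine Summable.of_nonneg_of_le (fun m => (lambertTerm_pos _ m).le) (fun m => ?_) ih
    rw [← lambertTerm_succ n m]
    refine le_mul_of_one_le_left (lambertTerm_pos _ m).le ?_
    have : (0 : ℝ) ≤ 2 * n + 2 * m := by positivity
    linarith

theorem lambertSum_pos (n : ℕ) : 0 < lambertSum n :=
  (summable_lambertTerm n).tsum_pos (fun m => (lambertTerm_pos n m).le) 0 (lambertTerm_pos n 0)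

/-- The termwise difference is `4 m * lambertTerm (n + 1) m`: it vanishes at `m = 0`, and shifting
the index turns it into `lambertTerm (n + 2)`. -/
theorem lambertSum_eq (n : ℕ) :
    lambertSum n = (4 * n + 2) * lambertSum (n + 1) + lambertSum (n + 2) := by
  have h1 := (summable_lambertTerm (n + 1)).mul_left (4 * n + 2 : ℝ)
  have h2 := (summable_lambertTerm n).sub h1
  have e : ∀ m, lambertTerm n m - (4 * n + 2) * lambertTerm (n + 1) m =
      4 * m * lambertTerm (n + 1) m := fun m => by
    rw [← lambertTerm_succ n m]; ring
  have h3 : ∑' m, (lambertTerm n m - (4 * n + 2) * lambertTerm (n + 1) m) = lambertSum (n + 2) := by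
    rw [h2.tsum_eq_zero_add, e 0]
    simp only [Nat.cast_zero, mul_zero, zero_mul, zero_add]
    refine tsum_congr fun m => ?_
    rw [e, lambertTerm_add_two]
    push_cast; ring
  rw [(summable_lambertTerm n).tsum_sub h1, tsum_mul_left] at h3
  unfold lambertSum at *
  linarith

/-- The iterates of `tanh (1/2) = (e - 1) / (e + 1)` under the Gauss map. -/
def lambertTail (k : ℕ) : ℝ := lambertSum (k + 1) / lambertSum k

theorem lambertTail_pos (k : ℕ) : 0 < lambertTail k := div_pos (lambertSum_pos _) (lambertSum_pos _)

theorem inv_lambertTail (k : ℕ) : (lambertTail k)⁻¹ = 4 * k + 2 + lambertTail (k + 1) := by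
  have h := (lambertSum_pos (k + 1)).ne'
  rw [lambertTail, lambertTail, inv_div, lambertSum_eq k]
  field_simp

theorem lambertTail_mul (k : ℕ) : lambertTail k * (4 * k + 2 + lambertTail (k + 1)) = 1 := by
  rw [← inv_lambertTail]
  exact mul_inv_cancel₀ (lambertTail_pos k).ne'

theorem lambertTail_mul_lt (k : ℕ) : lambertTail k * (4 * k + 2) < 1 := by
  have := lambertTail_mul k
  nlinarith [lambertTail_pos k, lambertTail_pos (k + 1)]

theorem lambertTail_lt_half (k : ℕ) : lambertTail k < 1 / 2 := by
  have := lambertTail_mul_lt k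
  have hk : (0 : ℝ) ≤ k := k.cast_nonneg
  nlinarith [lambertTail_pos k]

theorem lambertTail_mem_Ioo (k : ℕ) : lambertTail k ∈ Set.Ioo (0 : ℝ) 1 :=
  ⟨lambertTail_pos k, by linarith [lambertTail_lt_half k]⟩

theorem lambertTail_zero : lambertTail 0 = (Real.exp 1 - 1) / (Real.exp 1 + 1) := by
  have h0 : lambertSum 0 = Real.cosh (1 / 2) := hasSum_lambertTerm_zero.tsum_eq
  have h1 : lambertSum 1 = Real.sinh (1 / 2) := hasSum_lambertTerm_one.tsum_eq
  have e : Real.exp 1 = Real.exp (1 / 2) * Real.exp (1 / 2) := by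
    rw [← Real.exp_add]; norm_num
  have hp := Real.exp_pos (1 / 2)
  rw [lambertTail, h0, h1, Real.cosh_eq, Real.sinh_eq, Real.exp_neg, e]
  field_simp

theorem hasContFrac_tanh_half :
    HasContFrac ((Real.exp 1 - 1) / (Real.exp 1 + 1)) (fun n => 4 * n + 2) := by
  rw [← lambertTail_zero]
  exact hasContFrac_of_inv_eq lambertTail_mem_Ioo fun k => by
    rw [inv_lambertTail]; push_cast; ring

/-! ### The continued fraction of `e - 2` -/

/-- The iterates `3k` of `e - 2` under the Gauss map. -/
def eTail (k : ℕ) : ℝ := (1 - lambertTail (k + 1)) / (1 + lambertTail (k + 1))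

/-- The iterates `3k + 1` of `e - 2` under the Gauss map. -/
def eTailOne (k : ℕ) : ℝ := 2 * lambertTail (k + 1) / (1 - lambertTail (k + 1))

/-- The iterates `3k + 2` of `e - 2` under the Gauss map. -/
def eTailTwo (k : ℕ) : ℝ := (1 + lambertTail (k + 2)) / 2

theorem lambertTail_succ_lt_third (k : ℕ) : lambertTail (k + 1) < 1 / 3 := by
  have := lambertTail_mul_lt (k + 1)
  have hk : (0 : ℝ) ≤ k := k.cast_nonneg
  push_cast at this
  nlinarith [lambertTail_pos (k + 1)]

theorem eTail_mem_Ioo (k : ℕ) : eTail k ∈ Set.Ioo (0 : ℝ) 1 := by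
  have h := lambertTail_mem_Ioo (k + 1)
  have hp : 0 < 1 + lambertTail (k + 1) := by linarith [h.1]
  refine ⟨div_pos (by linarith [h.2]) hp, ?_⟩
  rw [eTail, div_lt_one hp]
  linarith [h.1]

theorem eTailOne_mem_Ioo (k : ℕ) : eTailOne k ∈ Set.Ioo (0 : ℝ) 1 := by
  have h := lambertTail_pos (k + 1)
  have h3 := lambertTail_succ_lt_third k
  refine ⟨div_pos (by linarith) (by linarith), ?_⟩
  rw [eTailOne, div_lt_one (by linarith)]
  linarith

theorem eTailTwo_mem_Ioo (k : ℕ) : eTailTwo k ∈ Set.Ioo (0 : ℝ) 1 := by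
  have h := lambertTail_mem_Ioo (k + 2)
  unfold eTailTwo
  constructor <;> linarith [h.1, h.2]

theorem eTail_mul (k : ℕ) : eTail k * (1 + eTailOne k) = 1 := by
  have h := lambertTail_mem_Ioo (k + 1)
  have h1 : 1 + lambertTail (k + 1) ≠ 0 := by linarith [h.1]
  have h2 : 1 - lambertTail (k + 1) ≠ 0 := by linarith [h.2]
  unfold eTail eTailOne
  field_simp
  ring

theorem eTailOne_mul (k : ℕ) : eTailOne k * (2 * (k + 1) + eTailTwo k) = 1 := by
  have h := lambertTail_mem_Ioo (k + 1)
  have h2 : 1 - lambertTail (k + 1) ≠ 0 := by linarith [h.2]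
  have h3 := lambertTail_mul (k + 1)
  unfold eTailOne eTailTwo
  rw [div_mul_eq_mul_div, div_eq_one_iff_eq h2]
  push_cast at h3
  linear_combination h3

theorem eTailTwo_mul (k : ℕ) : eTailTwo k * (1 + eTail (k + 1)) = 1 := by
  have h := lambertTail_pos (k + 2)
  have h2 : 1 + lambertTail (k + 2) ≠ 0 := by linarith
  unfold eTailTwo eTail
  rw [show k + 1 + 1 = k + 2 from rfl]
  field_simp
  ring

/-- An instance of `1 - [1, a, …] = [1 + a, …]`: reflection merges the quotients `1` and `2 (k + 1)`
into an odd one. -/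
theorem one_sub_eTail_mul (k : ℕ) : (1 - eTail k) * (2 * (k + 1) + 1 + eTailTwo k) = 1 := by
  have h := lambertTail_pos (k + 1)
  have h2 : 1 + lambertTail (k + 1) ≠ 0 := by linarith
  have h3 := lambertTail_mul (k + 1)
  have e : 1 - eTail k = 2 * lambertTail (k + 1) / (1 + lambertTail (k + 1)) := by
    unfold eTail; field_simp; ring
  rw [e, div_mul_eq_mul_div, div_eq_one_iff_eq h2, eTailTwo]
  push_cast at h3
  linear_combination h3

theorem eTail_zero : eTail 0 = Real.exp 1 - 2 := by
  have h := inv_lambertTail 0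
  have he : 1 < Real.exp 1 := Real.one_lt_exp_iff.2 one_pos
  have h1 : Real.exp 1 - 1 ≠ 0 := by linarith
  rw [lambertTail_zero, inv_div] at h
  have h' : lambertTail (0 + 1) = (3 - Real.exp 1) / (Real.exp 1 - 1) := by
    have e : lambertTail (0 + 1) = (Real.exp 1 + 1) / (Real.exp 1 - 1) - 2 := by
      rw [h]; push_cast; ring
    rw [e]; field_simp; ring
  have hp : 1 + (3 - Real.exp 1) / (Real.exp 1 - 1) = 2 / (Real.exp 1 - 1) := by
    field_simp; ring
  rw [eTail, h', hp]
  field_simp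
  ring

theorem hasContFrac_exp_one_sub_two :
    HasContFrac (Real.exp 1 - 2) (fun n => if n % 3 = 1 then 2 * (n / 3 + 1) else 1) := by
  let u : ℕ → ℝ := fun n =>
    if n % 3 = 0 then eTail (n / 3) else if n % 3 = 1 then eTailOne (n / 3) else eTailTwo (n / 3)
  have hu0 : u 0 = Real.exp 1 - 2 := by simp [u, eTail_zero]
  rw [← hu0]
  refine hasContFrac_of_inv_eq (fun n => ?_) (fun n => ?_)
  · simp only [u]
    split_ifs
    · exact eTail_mem_Ioo _
    · exact eTailOne_mem_Ioo _
    · exact eTailTwo_mem_Ioo _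
  · have h3 : n % 3 = 0 ∨ n % 3 = 1 ∨ n % 3 = 2 := by omega
    obtain ⟨k, hk⟩ : ∃ k, n / 3 = k := ⟨_, rfl⟩
    rcases h3 with h | h | h
    · have e1 : (n + 1) % 3 = 1 := by omega
      have e2 : (n + 1) / 3 = k := by omega
      simp only [u, h, e1, e2, hk, if_true, one_ne_zero, if_false, zero_ne_one]
      rw [inv_eq_of_mul_eq_one_right (eTail_mul k)]
      push_cast; ring
    · have e1 : (n + 1) % 3 = 2 := by omega
      have e2 : (n + 1) / 3 = k := by omega
      simp only [u, h, e1, e2, hk, if_true, one_ne_zero, if_false, OfNat.ofNat_ne_one,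
        OfNat.ofNat_ne_zero]
      rw [inv_eq_of_mul_eq_one_right (eTailOne_mul k)]
      push_cast; ring
    · have e1 : (n + 1) % 3 = 0 := by omega
      have e2 : (n + 1) / 3 = k + 1 := by omega
      simp only [u, h, e1, e2, hk, if_true, if_false, OfNat.ofNat_ne_one, OfNat.ofNat_ne_zero]
      rw [inv_eq_of_mul_eq_one_right (eTailTwo_mul k)]
      push_cast; ring

end ContFrac

/-! ### Dimension 1/2 and no isolated points for `(e - 1) / (e + 1)` -/

section LambertRotation

open Filter Topology
open scoped NNReal ENNReal

/-- The ratio by which the heavy set of `lambertTail (2 * k + 2)` is scaled in that of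
`lambertTail (2 * k)`. -/
def lambertScale (k : ℕ) : ℝ := lambertTail (2 * k) * lambertTail (2 * k + 1)

theorem lambertScale_pos (k : ℕ) : 0 < lambertScale k :=
  mul_pos (lambertTail_pos _) (lambertTail_pos _)

theorem lambertTail_even_mul (k : ℕ) :
    lambertTail (2 * k) * ((2 * (4 * k + 1) : ℕ) + lambertTail (2 * k + 1)) = 1 := by
  have := lambertTail_mul (2 * k)
  push_cast at this ⊢
  linear_combination this

theorem lambertTail_odd_mul (k : ℕ) :
    lambertTail (2 * k + 1) * ((8 * k + 6 : ℕ) + lambertTail (2 * (k + 1))) = 1 := by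
  have := lambertTail_mul (2 * k + 1)
  rw [show 2 * (k + 1) = 2 * k + 1 + 1 by ring]
  push_cast at this ⊢
  linear_combination this

theorem lambertTail_mem_Ico (k : ℕ) : lambertTail k ∈ Set.Ico (0 : ℝ) 1 :=
  Set.Ioo_subset_Ico_self (lambertTail_mem_Ioo k)

theorem mem_heavySet_lambertTail (k : ℕ) {w : ℝ} (hw : w ∈ heavySet (lambertTail (2 * (k + 1))))
    {j : ℕ} (hj : j ≤ 8 * k + 6) :
    lambertScale k * (j + w) ∈ heavySet (lambertTail (2 * k)) :=
  mem_heavySet_even (by omega) (lambertTail_pos _) (lambertTail_even_mul k)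
    (lambertTail_mem_Ioo _) (lambertTail_mem_Ico _) (by omega) (lambertTail_odd_mul k) hw hj

theorem exists_of_mem_heavySet_lambertTail (k : ℕ) {x : ℝ}
    (hx : x ∈ heavySet (lambertTail (2 * k))) :
    ∃ j ≤ 8 * k + 6, ∃ w ∈ heavySet (lambertTail (2 * (k + 1))), x = lambertScale k * (j + w) := by
  obtain ⟨j, w, hw, e, hle⟩ := exists_of_mem_heavySet_even (by omega) (lambertTail_pos _)
    (lambertTail_even_mul k) (lambertTail_mem_Ioo _) (lambertTail_mem_Ico _) (by omega)
    (lambertTail_odd_mul k) hx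
  refine ⟨j, ?_, w, hw, e⟩
  -- With `b = 8k + 6`, `η = lambertTail (2k + 1)` and `ζ = lambertTail (2k + 2)`, an index above
  -- `b` would give `η (b + 1) ≤ 1 + η / 2 = η (b + ζ) + η / 2`, contradicting `ζ < 1/2`.
  by_contra! hc
  have hc' : ((8 * k + 6 : ℕ) : ℝ) + 1 ≤ j := by exact_mod_cast hc
  have h := lambertTail_odd_mul k
  have := lambertTail_pos (2 * k + 1)
  have := lambertTail_lt_half (2 * (k + 1))
  have := hw.1.1
  nlinarith

/-- The digit base `4k + 3` is half the partial quotient `8k + 6`, which leaves room for doubled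
digits. -/
theorem two_mul_digits_mul_lambertScale_le (k : ℕ) :
    2 * (4 * k + 3 : ℕ) * lambertScale k ≤ 1 := by
  have h := lambertTail_odd_mul k
  have h0 := lambertTail_pos (2 * k)
  have h1 := lambertTail_pos (2 * k + 1)
  have h2 := lambertTail_pos (2 * (k + 1))
  have h3 := lambertTail_lt_half (2 * k)
  unfold lambertScale
  push_cast at h ⊢
  have : lambertTail (2 * k + 1) * (8 * k + 6) ≤ 1 := by nlinarith
  nlinarith

theorem heavyUpTo_digitPoint (N : ℕ) : ∀ k, ∀ t ∈ Set.Ico (0 : ℝ) 1,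
    HeavyUpTo (rot (lambertTail (2 * k))) signFun N
      (digitPoint (fun k => 4 * k + 3) lambertScale k t) := by
  have hm : ∀ k, 1 ≤ 4 * k + 3 := fun k => by omega
  induction N with
  | zero =>
    intro k t _ m hm
    obtain rfl : m = 0 := by omega
    simp
  | succ N ih =>
    intro k t ht
    rw [digitPoint_eq hm lambertScale_pos two_mul_digits_mul_lambertScale_le k ht]
    have hd := floor_mul_add_one_le (hm k) ht
    have := heavyUpTo_rot_even (n := 4 * k + 1) (by omega) (lambertTail_pos _)
      (lambertTail_even_mul k) (lambertTail_mem_Ioo _) (lambertTail_mem_Ico _) (by omega)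
      (lambertTail_odd_mul k)
      (digitPoint_mem_Ico hm lambertScale_pos two_mul_digits_mul_lambertScale_le (k + 1)
        (fract_mem_Ico _)) (ih (k + 1) _ (fract_mem_Ico ((4 * k + 3 : ℕ) * t)))
      (j := 2 * ⌊((4 * k + 3 : ℕ) : ℝ) * t⌋₊) (by omega)
    simpa [lambertScale] using this

theorem digitPoint_mem_heavySet (k : ℕ) {t : ℝ} (ht : t ∈ Set.Ico (0 : ℝ) 1) :
    digitPoint (fun k => 4 * k + 3) lambertScale k t ∈ heavySet (lambertTail (2 * k)) :=
  mem_heavySet_iff.2 ⟨digitPoint_mem_Ico (fun k => by omega) lambertScale_pos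
    two_mul_digits_mul_lambertScale_le k ht,
    heavy_iff_forall_heavyUpTo.2 fun N => heavyUpTo_digitPoint N k t ht⟩

theorem lambertScale_le_inv_sq (k : ℕ) : lambertScale k ≤ ((8 * k + 2 : ℝ) ^ 2)⁻¹ := by
  have h1 := lambertTail_mul_lt (2 * k)
  have h2 := lambertTail_mul_lt (2 * k + 1)
  have p1 := lambertTail_pos (2 * k)
  have p2 := lambertTail_pos (2 * k + 1)
  have hk : (0 : ℝ) ≤ k := k.cast_nonneg
  push_cast at h1 h2
  have h1' : lambertTail (2 * k) ≤ (8 * k + 2 : ℝ)⁻¹ := by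
    rw [← one_div, le_div_iff₀ (by positivity)]; nlinarith
  have h2' : lambertTail (2 * k + 1) ≤ (8 * k + 2 : ℝ)⁻¹ := by
    rw [← one_div, le_div_iff₀ (by positivity)]; nlinarith
  calc lambertScale k ≤ (8 * k + 2 : ℝ)⁻¹ * (8 * k + 2 : ℝ)⁻¹ :=
        mul_le_mul h1' h2' p2.le (by positivity)
    _ = ((8 * k + 2 : ℝ) ^ 2)⁻¹ := by rw [← mul_inv, sq]

theorem inv_sq_le_lambertScale (k : ℕ) : ((8 * k + 8 : ℝ) ^ 2)⁻¹ ≤ lambertScale k := by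
  have h1 := lambertTail_mul (2 * k)
  have h2 := lambertTail_mul (2 * k + 1)
  have p1 := lambertTail_pos (2 * k)
  have p2 := lambertTail_pos (2 * k + 1)
  have p3 := (lambertTail_mem_Ioo (2 * k + 1)).2
  have p4 := (lambertTail_mem_Ioo (2 * k + 1 + 1)).2
  have hk : (0 : ℝ) ≤ k := k.cast_nonneg
  push_cast at h1 h2
  have h1' : (8 * k + 8 : ℝ)⁻¹ ≤ lambertTail (2 * k) := by
    rw [← one_div, div_le_iff₀ (by positivity), ← h1]
    exact mul_le_mul_of_nonneg_left (by linarith) p1.le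
  have h2' : (8 * k + 8 : ℝ)⁻¹ ≤ lambertTail (2 * k + 1) := by
    rw [← one_div, div_le_iff₀ (by positivity), ← h2]
    exact mul_le_mul_of_nonneg_left (by linarith) p2.le
  calc ((8 * k + 8 : ℝ) ^ 2)⁻¹ = (8 * k + 8 : ℝ)⁻¹ * (8 * k + 8 : ℝ)⁻¹ := by rw [← mul_inv, sq]
    _ ≤ lambertScale k := mul_le_mul h1' h2' (by positivity) p1.le

theorem inv_sq_rpow {x : ℝ} (hx : 0 ≤ x) (d : ℝ) : ((x ^ 2)⁻¹) ^ d = (x ^ (2 * d))⁻¹ := by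
  rw [Real.inv_rpow (sq_nonneg x), Real.rpow_mul hx]
  norm_num

theorem eventually_le_rpow_affine {p : ℝ} (hp : 0 < p) {a b : ℝ} (ha : 0 < a) (C : ℝ) :
    ∀ᶠ k : ℕ in atTop, C ≤ (a * k + b) ^ p :=
  ((tendsto_rpow_atTop hp).comp (tendsto_atTop_add_const_right _ b
    (tendsto_natCast_atTop_atTop.const_mul_atTop ha))).eventually_ge_atTop C

theorem dimH_heavySet_lambert_le {d : ℝ≥0} (hd : 1 / 2 < d) :
    dimH (heavySet (lambertTail 0)) ≤ d := by
  have hd' : (1 / 2 : ℝ) < d := by exact_mod_cast hd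
  refine dimH_le_of_scaled_covers (H := fun k => heavySet (lambertTail (2 * k)))
    (N := fun k => 8 * k + 7) (c := lambertScale)
    (fun k x hx => ⟨hx.1.1, hx.1.2.le⟩) lambertScale_pos (fun k => ?_) (fun k => ?_) ?_
  · have h0 := lambertTail_pos (2 * k)
    have h1 := lambertTail_pos (2 * k + 1)
    have h2 := lambertTail_lt_half (2 * k)
    have h3 := lambertTail_lt_half (2 * k + 1)
    unfold lambertScale
    nlinarith
  · refine ⟨fun j => lambertScale k * j, fun x hx => ?_⟩
    obtain ⟨j, hj, w, hw, e⟩ := exists_of_mem_heavySet_lambertTail k hx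
    exact ⟨j, by omega, w, hw, by rw [e]; ring⟩
  -- As `8k + 7 ≤ 4 (8k + 2)`, the surplus power `2d - 1 > 0` only has to beat 4.
  · filter_upwards [eventually_le_rpow_affine (p := 2 * d - 1) (by linarith)
      (by norm_num : (0 : ℝ) < 8) 4 (b := 2)] with k hk
    have hx : (0 : ℝ) < 8 * k + 2 := by positivity
    have h1 : lambertScale k ^ (d : ℝ) ≤ ((8 * k + 2 : ℝ) ^ (2 * (d : ℝ)))⁻¹ := by
      rw [← inv_sq_rpow hx.le]
      exact Real.rpow_le_rpow (lambertScale_pos k).le (lambertScale_le_inv_sq k) d.coe_nonneg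
    have h2 : (8 * k + 2 : ℝ) ^ (2 * (d : ℝ)) = (8 * k + 2) ^ (2 * (d : ℝ) - 1) * (8 * k + 2) := by
      rw [← Real.rpow_add_one hx.ne']; ring_nf
    have h3 : ((8 * k + 7 : ℕ) : ℝ) ≤ (8 * k + 2 : ℝ) ^ (2 * (d : ℝ)) := by
      rw [h2]; push_cast; nlinarith
    calc ((8 * k + 7 : ℕ) : ℝ) * lambertScale k ^ (d : ℝ)
        ≤ (8 * k + 2 : ℝ) ^ (2 * (d : ℝ)) * ((8 * k + 2 : ℝ) ^ (2 * (d : ℝ)))⁻¹ :=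
          mul_le_mul h3 h1 (Real.rpow_nonneg (lambertScale_pos k).le _) (by positivity)
      _ = 1 := mul_inv_cancel₀ (Real.rpow_pos_of_pos hx _).ne'

theorem le_dimH_heavySet_lambert {s : ℝ≥0} (hs0 : 0 < s) (hs : s < 1 / 2) :
    (s : ℝ≥0∞) ≤ dimH (heavySet (lambertTail 0)) := by
  have hs' : (s : ℝ) < 1 / 2 := by exact_mod_cast hs
  refine (le_dimH_image_digitPoint (m := fun k => 4 * k + 3) (c := lambertScale)
    (fun k => by omega) lambertScale_pos two_mul_digits_mul_lambertScale_le hs0 ?_).trans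
    (dimH_mono ?_)
  -- As `8k + 16 ≤ 8 (4k + 3)`, the missing power `1 - 2s > 0` only has to beat 8.
  · filter_upwards [eventually_le_rpow_affine (p := 1 - 2 * s) (by linarith)
      (by norm_num : (0 : ℝ) < 8) 8 (b := 16)] with k hk
    have hx : (0 : ℝ) < 8 * k + 16 := by positivity
    have h1 : ((8 * k + 16 : ℝ) ^ (2 * (s : ℝ)))⁻¹ ≤ lambertScale (k + 1) ^ (s : ℝ) := by
      rw [← inv_sq_rpow hx.le]
      refine Real.rpow_le_rpow (by positivity) ?_ s.coe_nonneg
      refine le_trans (le_of_eq ?_) (inv_sq_le_lambertScale (k + 1))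
      push_cast; ring
    have hpos := Real.rpow_pos_of_pos hx (2 * (s : ℝ))
    have h2 : (8 * k + 16 : ℝ) ^ (1 - 2 * (s : ℝ)) * (8 * k + 16) ^ (2 * (s : ℝ)) =
        8 * k + 16 := by
      rw [← Real.rpow_add hx]; simp
    have h3 : (8 * k + 16 : ℝ) ^ (2 * (s : ℝ)) ≤ (4 * k + 3 : ℕ) := by
      push_cast
      nlinarith
    calc (1 : ℝ) = (8 * k + 16 : ℝ) ^ (2 * (s : ℝ)) * ((8 * k + 16 : ℝ) ^ (2 * (s : ℝ)))⁻¹ :=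
          (mul_inv_cancel₀ hpos.ne').symm
      _ ≤ (4 * k + 3 : ℕ) * lambertScale (k + 1) ^ (s : ℝ) :=
          mul_le_mul h3 h1 (inv_pos.2 hpos).le (Nat.cast_nonneg _)
  · rintro _ ⟨t, ht, rfl⟩
    exact digitPoint_mem_heavySet 0 ht

theorem dimH_heavySet_lambert : dimH (heavySet (lambertTail 0)) = 1 / 2 := by
  have e : (1 / 2 : ℝ≥0∞) = ((1 / 2 : ℝ≥0) : ℝ≥0∞) := by
    rw [ENNReal.coe_div two_ne_zero]; simp
  rw [e]
  refine le_antisymm (le_of_forall_gt_imp_ge_of_dense fun d hd => ?_)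
    (ENNReal.le_of_forall_nnreal_lt fun s hs => ?_)
  · obtain ⟨d', h1, h2⟩ := ENNReal.lt_iff_exists_nnreal_btwn.1 hd
    exact (dimH_heavySet_lambert_le (by exact_mod_cast h1)).trans h2.le
  · rcases eq_or_ne s 0 with rfl | h0
    · simp
    · exact le_dimH_heavySet_lambert (pos_iff_ne_zero.2 h0) (by exact_mod_cast hs)

/-- Within a copy the later heavy point can be exchanged, and each level at least halves distances.
At the deepest level the copies `j = 0` and `j = 1` of one heavy point cannot both equal `x`. -/
theorem exists_ne_mem_heavySet_lambertTail (n : ℕ) :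
    ∀ k, ∀ x ∈ heavySet (lambertTail (2 * k)),
      ∃ y ∈ heavySet (lambertTail (2 * k)), y ≠ x ∧ |y - x| ≤ (1 / 2) ^ n := by
  induction n with
  | zero =>
    intro k x hx
    have hw := digitPoint_mem_heavySet (k + 1) (t := 0) (by simp)
    set w := digitPoint (fun k => 4 * k + 3) lambertScale (k + 1) 0
    have h0 := mem_heavySet_lambertTail k hw (j := 0) (by omega)
    have h1 := mem_heavySet_lambertTail k hw (j := 1) (by omega)
    have hne : lambertScale k * ((0 : ℕ) + w) ≠ lambertScale k * ((1 : ℕ) + w) := by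
      push_cast
      have := lambertScale_pos k
      intro h
      nlinarith
    have hd : ∀ y ∈ heavySet (lambertTail (2 * k)), |y - x| ≤ (1 / 2) ^ 0 := fun y hy => by
      rw [pow_zero, abs_le]
      constructor <;> linarith [hy.1.1, hy.1.2, hx.1.1, hx.1.2]
    by_cases hx0 : lambertScale k * ((0 : ℕ) + w) = x
    · exact ⟨_, h1, fun h => hne (hx0.trans h.symm), hd _ h1⟩
    · exact ⟨_, h0, hx0, hd _ h0⟩
  | succ n ih =>
    intro k x hx
    obtain ⟨j, hj, w, hw, rfl⟩ := exists_of_mem_heavySet_lambertTail k hx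
    obtain ⟨v, hv, hne, hle⟩ := ih (k + 1) w hw
    refine ⟨_, mem_heavySet_lambertTail k hv hj, fun h => hne ?_, ?_⟩
    · exact add_left_cancel (mul_left_cancel₀ (lambertScale_pos k).ne' h)
    · have h0 := lambertTail_pos (2 * k)
      have h1 := lambertTail_pos (2 * k + 1)
      have h2 := lambertTail_lt_half (2 * k)
      have h3 := lambertTail_lt_half (2 * k + 1)
      have hc : lambertScale k ≤ 1 / 2 := by unfold lambertScale; nlinarith
      rw [← mul_sub, add_sub_add_left_eq_sub, abs_mul, abs_of_pos (lambertScale_pos k), pow_succ']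
      exact mul_le_mul hc hle (abs_nonneg _) (by norm_num)

theorem preperfect_heavySet_lambert : Preperfect (heavySet (lambertTail 0)) := by
  intro x hx
  rw [accPt_iff_nhds]
  intro U hU
  obtain ⟨ε, hε, hball⟩ := Metric.mem_nhds_iff.1 hU
  obtain ⟨n, hn⟩ := exists_pow_lt_of_lt_one hε (by norm_num : (1 / 2 : ℝ) < 1)
  obtain ⟨y, hy, hne, hle⟩ := exists_ne_mem_heavySet_lambertTail n 0 x hx
  exact ⟨y, ⟨hball (by rw [Metric.mem_ball, Real.dist_eq]; exact hle.trans_lt hn), hy⟩, hne⟩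

end LambertRotation

/-! ### Dimension 0 for `e - 2` -/

section ERotation

open Filter Topology
open scoped NNReal ENNReal

/-- The ratio by which the heavy set of `eTail (j + 2)` is scaled in that of `eTail j`. -/
def eScale (j : ℕ) : ℝ :=
  (1 - eTail j) * (1 - eTailTwo j) * (eTailOne (j + 1) * eTailTwo (j + 1))

theorem eScale_pos (j : ℕ) : 0 < eScale j :=
  mul_pos (mul_pos (by linarith [(eTail_mem_Ioo j).2]) (by linarith [(eTailTwo_mem_Ioo j).2]))
    (mul_pos (eTailOne_mem_Ioo _).1 (eTailTwo_mem_Ioo _).1)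

theorem eScale_le (j : ℕ) : eScale j ≤ (2 * j + 2 : ℝ)⁻¹ := by
  have h1 := eTail_mem_Ioo j
  have h2 := eTailTwo_mem_Ioo j
  have h3 := eTailOne_mem_Ioo (j + 1)
  have h4 := eTailTwo_mem_Ioo (j + 1)
  have h := one_sub_eTail_mul j
  have h5 : 1 - eTail j ≤ (2 * j + 2 : ℝ)⁻¹ := by
    rw [← one_div, le_div_iff₀ (by positivity)]
    nlinarith [h1.2, h2.1]
  have h6 : eTailOne (j + 1) * eTailTwo (j + 1) ≤ 1 :=
    mul_le_one₀ h3.2.le h4.1.le h4.2.le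
  have h7 : (1 - eTail j) * (1 - eTailTwo j) ≤ 1 - eTail j :=
    mul_le_of_le_one_right (by linarith [h1.2]) (by linarith [h2.1])
  exact (mul_le_of_le_one_right
    (mul_nonneg (by linarith [h1.2]) (by linarith [h2.2])) h6).trans (h7.trans h5)

/-- Here `b = 1`, so `1 = η (1 + ζ) < 2η` and `η (i + w) ≤ 1 + η / 2 < 3η`. -/
theorem exists_of_mem_heavySet_eTailOne (j : ℕ) {x : ℝ} (hx : x ∈ heavySet (eTailOne (j + 1))) :
    ∃ i < 3, ∃ w ∈ heavySet (eTail (j + 2)),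
      x = eTailOne (j + 1) * eTailTwo (j + 1) * ((i : ℕ) + w) := by
  have hm : eTailTwo (j + 1) * ((1 : ℕ) + eTail (j + 2)) = 1 := by
    rw [Nat.cast_one]; exact eTailTwo_mul (j + 1)
  obtain ⟨i, w, hw, e, hle⟩ := exists_of_mem_heavySet_even (n := j + 2) (b := 1) (by omega)
    (eTailOne_mem_Ioo (j + 1)).1
    (by have := eTailOne_mul (j + 1); push_cast at this ⊢; linear_combination this)
    (eTailTwo_mem_Ioo (j + 1)) (Set.Ioo_subset_Ico_self (eTail_mem_Ioo (j + 2))) le_rfl hm hx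
  refine ⟨i, ?_, w, hw, e⟩
  by_contra! hc
  have hc' : (3 : ℝ) ≤ i := by exact_mod_cast hc
  have h1 := (eTailTwo_mem_Ioo (j + 1)).1
  have h2 := (eTail_mem_Ioo (j + 2)).2
  have h3 := hw.1.1
  push_cast at hm
  nlinarith

/-- For `b = 1` the odd step has the shifts `j ≤ 2` and one more from position 1, stored as index 3.
-/
theorem exists_of_mem_heavySet_one_sub_eTail (j : ℕ) : ∃ φ : ℕ → ℝ,
    ∀ x ∈ heavySet (1 - eTail j), ∃ i < 4, ∃ w ∈ heavySet (1 - eTailOne (j + 1)),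
      x = φ i + (1 - eTail j) * (1 - eTailTwo j) * w := by
  refine ⟨fun i => if i = 3 then (1 - eTail j) * (1 + eTailTwo j)
    else (1 - eTail j) * (eTailTwo j - (1 - eTailTwo j) * i), fun x hx => ?_⟩
  obtain ⟨w, hw, e | ⟨i, hi, e⟩⟩ := exists_of_mem_heavySet_odd (n := j + 1) (b := 1) (by omega)
    (by linarith [(eTail_mem_Ioo j).2])
    (by have := one_sub_eTail_mul j; push_cast at this ⊢; linear_combination this)
    (eTailTwo_mem_Ioo j) (eTailOne_mem_Ioo (j + 1)) (eTailTwo_mul j)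
    (by rw [Nat.cast_one]; exact eTail_mul (j + 1)) hx
  · exact ⟨3, by norm_num, w, hw, by simpa using e⟩
  · exact ⟨i, by omega, w, hw, by simpa only [if_neg (show i ≠ 3 by omega)] using e⟩

theorem exists_of_mem_heavySet_eTail (j : ℕ) : ∃ φ : ℕ → ℝ,
    ∀ x ∈ heavySet (eTail j), ∃ i < 12, ∃ y ∈ heavySet (eTail (j + 2)),
      x = φ i + eScale j * y := by
  obtain ⟨φ, hφ⟩ := exists_of_mem_heavySet_one_sub_eTail j
  -- The index `i = 3p + q` joins the 4 choices of the odd step with the 3 of the even step. The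
  -- terms with halves come from the two reflections, the second one inside a copy.
  refine ⟨fun i => 1 / 2 - φ (i / 3) - (1 - eTail j) * (1 - eTailTwo j) / 2 +
    eScale j * (i % 3 : ℕ), fun x hx => ?_⟩
  obtain ⟨p, hp, w, hw, e⟩ := hφ _ (half_sub_mem_heavySet hx)
  have hw' := half_sub_mem_heavySet hw
  rw [sub_sub_cancel] at hw'
  obtain ⟨q, hq, y, hy, e'⟩ := exists_of_mem_heavySet_eTailOne j hw'
  refine ⟨3 * p + q, by omega, y, hy, ?_⟩
  have e1 : (3 * p + q) / 3 = p := by omega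
  have e2 : (3 * p + q) % 3 = q := by omega
  simp only [e1, e2, eScale]
  linear_combination -e + (1 - eTail j) * (1 - eTailTwo j) * e'

theorem dimH_heavySet_eTail_le {d : ℝ≥0} (hd : 0 < d) : dimH (heavySet (eTail 0)) ≤ d := by
  have hd' : (0 : ℝ) < d := by exact_mod_cast hd
  refine dimH_le_of_scaled_covers (H := fun k => heavySet (eTail (2 * k)))
    (N := fun _ => 12) (c := fun k => eScale (2 * k))
    (fun k x hx => ⟨hx.1.1, hx.1.2.le⟩) (fun k => eScale_pos _) (fun k => ?_)
    (fun k => exists_of_mem_heavySet_eTail (2 * k)) ?_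
  · refine (eScale_le _).trans ?_
    rw [← one_div]
    refine one_div_le_one_div_of_le (by norm_num) ?_
    have : (0 : ℝ) ≤ 2 * (2 * k : ℕ) := by positivity
    linarith
  -- The number of copies stays 12 while the ratio tends to 0, so any positive exponent is enough.
  · filter_upwards [eventually_le_rpow_affine hd' (by norm_num : (0 : ℝ) < 4) 12 (b := 2)] with k hk
    have hx : (0 : ℝ) < 4 * k + 2 := by positivity
    have h1 : eScale (2 * k) ^ (d : ℝ) ≤ ((4 * k + 2 : ℝ) ^ (d : ℝ))⁻¹ := by
      rw [← Real.inv_rpow hx.le]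
      refine Real.rpow_le_rpow (eScale_pos _).le ((eScale_le _).trans (le_of_eq ?_)) d.coe_nonneg
      push_cast; ring
    calc ((12 : ℕ) : ℝ) * eScale (2 * k) ^ (d : ℝ)
        ≤ (4 * k + 2 : ℝ) ^ (d : ℝ) * ((4 * k + 2 : ℝ) ^ (d : ℝ))⁻¹ :=
          mul_le_mul (by exact_mod_cast hk) h1 (Real.rpow_nonneg (eScale_pos _).le _)
            (by positivity)
      _ = 1 := mul_inv_cancel₀ (Real.rpow_pos_of_pos hx _).ne'

theorem dimH_heavySet_eTail : dimH (heavySet (eTail 0)) = 0 := by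
  refine le_antisymm (le_of_forall_gt_imp_ge_of_dense fun d hd => ?_) zero_le
  obtain ⟨d', h1, h2⟩ := ENNReal.lt_iff_exists_nnreal_btwn.1 hd
  exact (dimH_heavySet_eTail_le (by exact_mod_cast h1)).trans h2.le

end ERotation

end HeavySets

end

theorem mainTheorem10 :
    (HeavySets.HasContFrac (Real.exp 1 - 2)
        (fun n => if n % 3 = 1 then 2 * (n / 3 + 1) else 1) ∧
      dimH (HeavySets.heavySet (Real.exp 1 - 2)) = 0) ∧
    (HeavySets.HasContFrac ((Real.exp 1 - 1) / (Real.exp 1 + 1)) (fun n => 4 * n + 2) ∧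
      dimH (HeavySets.heavySet ((Real.exp 1 - 1) / (Real.exp 1 + 1))) = 1 / 2 ∧
      Preperfect (HeavySets.heavySet ((Real.exp 1 - 1) / (Real.exp 1 + 1)))) := by
  refine ⟨⟨HeavySets.hasContFrac_exp_one_sub_two, ?_⟩, HeavySets.hasContFrac_tanh_half, ?_, ?_⟩
  · rw [← HeavySets.eTail_zero]
    exact HeavySets.dimH_heavySet_eTail
  · rw [← HeavySets.lambertTail_zero]
    exact HeavySets.dimH_heavySet_lambert
  · rw [← HeavySets.lambertTail_zero]
    exact HeavySets.preperfect_heavySet_lambert
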